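/- Let $n\ge 2$, let $1<p<\infty$, and let $H:\mathbb R^n\to[0,\infty)$ be convex, of class $C^1$ on $\mathbb R^n\setminus\{0\}$, with $H(t\xi)=|t|H(\xi)$ for all $t\in\mathbb R$, $\xi\in\mathbb R^n$, and with $\alpha|\xi|\le H(\xi)\le\beta|\xi|$ for some constants $0<\alpha\le\beta$. Let $\Omega\subset\mathbb R^n$ be nonempty, bounded, convex and open. Denote by $|\Omega|$ its Lebesgue measure, by $$P_H(\Omega)=\int_{\partial\Omega}H(\nu_\Omega)\,d\mathcal H^{n-1}$$ its anisotropic perimeter ($\nu_\Omega$ is the outer unit normal), and by $\tau_p(\Omega)$ its anisotropic $p$-torsional rigidity, defined by $$\tau_p(\Omega)^{p-1}=\sup\left\{\frac{\left(\int_\Omega\psi\,dx\right)^p}{\int_\Omega H(D\psi)^p\,dx}\;:\;\psi\in W_0^{1,p}(\Omega)\setminus\{0\},\ \psi\ge 0\right\}.$$ Then $$\tau_p(\Omega)\;\ge\;\frac{p-1}{2p-1}\,\frac{|\Omega|^{\frac{2p-1}{p-1}}}{P_H(\Omega)^{\frac p{p-1}}}.$$ The same lower bound holds for $\int_\Omega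 u\,dx$ (the other expression of $\tau_p(\Omega)$) whenever $u\in W_0^{1,p}(\Omega)$ is a weak solution of $-\operatorname{div}\big(H(Du)^{p-1}\nabla H(Du)\big)=1$ in $\Omega$, $u=0$ on $\partial\Omega$, that is, $$\int_\Omega H(Du)^{p-1}\,\nabla H(Du)\cdot D\varphi\,dx=\int_\Omega\varphi\,dx\qquad\text{for all }\varphi\in W_0^{1,p}(\Omega),$$ where $H(Du)^{p-1}\nabla H(Du)$ is read as $0$ where $Du=0$. -/

import Mathlib

open MeasureTheory Filter Topology
open scoped ENNReal ContDiff

/-- An anisotropic norm on `ℝⁿ`: a convex function, `C¹` away from the origin, absolutely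
homogeneous of degree one, and comparable to the Euclidean norm. -/
structure IsAnisotropicNorm {n : ℕ} (H : EuclideanSpace ℝ (Fin n) → ℝ) : Prop where
  convexOn : ConvexOn ℝ Set.univ H
  contDiffOn : ContDiffOn ℝ 1 H {0}ᶜ
  map_smul : ∀ (t : ℝ) (ξ : EuclideanSpace ℝ (Fin n)), H (t • ξ) = |t| * H ξ
  bounds : ∃ α β : ℝ, 0 < α ∧ α ≤ β ∧
    ∀ ξ : EuclideanSpace ℝ (Fin n), α * ‖ξ‖ ≤ H ξ ∧ H ξ ≤ β * ‖ξ‖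

/-- `ν` is an outer unit normal to the convex set `K` at the point `x` of its boundary. -/
def IsOuterUnitNormal {n : ℕ} (K : Set (EuclideanSpace ℝ (Fin n)))
    (x ν : EuclideanSpace ℝ (Fin n)) : Prop :=
  ‖ν‖ = 1 ∧ ∀ y ∈ K, inner ℝ ν (y - x) ≤ 0

open Classical in
/-- The outer unit normal field of a convex set `K`. It is uniquely determined at almost every
boundary point (with respect to surface measure); at the other boundary points one of the outer
unit normals is chosen. -/
noncomputable def outerUnitNormal {n : ℕ} (K : Set (EuclideanSpace ℝ (Fin n)))
    (x : EuclideanSpace ℝ (Fin n)) : EuclideanSpace ℝ (Fin n) :=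
  if h : ∃ ν, IsOuterUnitNormal K x ν then h.choose else 0

/-- The anisotropic perimeter `P_H(K) = ∫_{∂K} H(ν_K) dℋⁿ⁻¹` of a bounded convex open set `K`.
Here `μHE[n - 1]` is the `(n-1)`-dimensional Hausdorff measure with the usual (Euclidean)
normalization. -/
noncomputable def anisotropicPerimeter {n : ℕ} (H : EuclideanSpace ℝ (Fin n) → ℝ)
    (K : Set (EuclideanSpace ℝ (Fin n))) : ℝ≥0∞ :=
  ∫⁻ x in frontier K, ENNReal.ofReal (H (outerUnitNormal K x)) ∂μHE[n - 1]

/-- `u ∈ W₀^{1,p}(Ω)` with weak gradient `Du = g`: the pair `(u, g)` is in the closure, in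
`Lᵖ(Ω) × Lᵖ(Ω; ℝⁿ)`, of the pairs `(φ, ∇φ)` with `φ ∈ C_c^∞(Ω)`. -/
def MemSobolevZero {n : ℕ} (p : ℝ) (Ω : Set (EuclideanSpace ℝ (Fin n)))
    (u : EuclideanSpace ℝ (Fin n) → ℝ)
    (g : EuclideanSpace ℝ (Fin n) → EuclideanSpace ℝ (Fin n)) : Prop :=
  MemLp u (ENNReal.ofReal p) (volume.restrict Ω) ∧
  MemLp g (ENNReal.ofReal p) (volume.restrict Ω) ∧
  ∃ φ : ℕ → EuclideanSpace ℝ (Fin n) → ℝ,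
    (∀ k, ContDiff ℝ ∞ (φ k) ∧ HasCompactSupport (φ k) ∧ tsupport (φ k) ⊆ Ω) ∧
    Tendsto (fun k => eLpNorm (fun x => φ k x - u x) (ENNReal.ofReal p) (volume.restrict Ω))
      atTop (𝓝 0) ∧
    Tendsto (fun k => eLpNorm (fun x => gradient (φ k) x - g x) (ENNReal.ofReal p)
      (volume.restrict Ω)) atTop (𝓝 0)

/-- The values `(∫_Ω ψ)^p / ∫_Ω H(Dψ)^p`, for `ψ ∈ W₀^{1,p}(Ω) \ {0}` with `ψ ≥ 0`. -/
def torsionQuotients {n : ℕ} (H : EuclideanSpace ℝ (Fin n) → ℝ) (p : ℝ)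
    (Ω : Set (EuclideanSpace ℝ (Fin n))) : Set ℝ :=
  {q | ∃ ψ g, MemSobolevZero p Ω ψ g ∧ ¬ (ψ =ᵐ[volume.restrict Ω] 0) ∧
    (0 ≤ᵐ[volume.restrict Ω] ψ) ∧ q = (∫ x in Ω, ψ x) ^ p / ∫ x in Ω, H (g x) ^ p}

/-- The anisotropic `p`-torsional rigidity `τ_p(Ω)`, the number such that `τ_p(Ω)^(p-1)` is the
maximum, written here as the supremum, of the values in `torsionQuotients`. -/
noncomputable def torsionalRigidity {n : ℕ} (H : EuclideanSpace ℝ (Fin n) → ℝ) (p : ℝ)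
    (Ω : Set (EuclideanSpace ℝ (Fin n))) : ℝ :=
  sSup (torsionQuotients H p Ω) ^ (1 / (p - 1))

/-- `u ∈ W₀^{1,p}(Ω)`, with weak gradient `Du = g`, is a weak solution of the torsion problem
`-div (H(Du)^(p-1) ∇H(Du)) = 1` in `Ω`, `u = 0` on `∂Ω`. Where `Du = 0` the vector
`H(Du)^(p-1) ∇H(Du)` is `0`, as it should be, because `H 0 = 0`. -/
def IsTorsionFunction {n : ℕ} (H : EuclideanSpace ℝ (Fin n) → ℝ) (p : ℝ)
    (Ω : Set (EuclideanSpace ℝ (Fin n))) (u : EuclideanSpace ℝ (Fin n) → ℝ)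
    (g : EuclideanSpace ℝ (Fin n) → EuclideanSpace ℝ (Fin n)) : Prop :=
  MemSobolevZero p Ω u g ∧
  ∀ φ Dφ, MemSobolevZero p Ω φ Dφ →
    ∫ x in Ω, H (g x) ^ (p - 1) * inner ℝ (gradient H (g x)) (Dφ x) = ∫ x in Ω, φ x

/-! The test functions are `f ∘ δ`, where `δ` is the anisotropic distance to the boundary. Let
`V(t)` be the volume of `{x ∈ Ω | t < δ x}`, let `P` be the perimeter, and choose `f' = V ^
(1/(p-1))`, `f(0) = 0`. With `q = p/(p-1)` the layer cake formula gives `∫ f(δ) = ∫ V(t)^q dt`,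
while `H(D(f ∘ δ)) ≤ f'(δ)` gives `∫ H(D(f ∘ δ))^p ≤ ∫ V(δ)^q`. Put `A = |Ω|^(q+1)/(q+1)`. As `V` is
continuous, `V(δ)` is uniformly distributed on `[0, |Ω|]`, so the second integral is at most `A`
(`lintegral_tailMeasure_comp_le`). If `V` decreases at rate at most `P`, the first is at least `A/P`
(`le_lintegral_tailMeasure`). The quotient is then at least `(A/P)^p / A = A^(p-1) / P^p`, which is
the claim raised to the power `p-1`. `exists_smooth_comp_boundaryDist` makes the test functions
smooth.

The geometric input is that the layer `{s < δ < t}` has volume at most `P (t-s)`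
(`exists_boundaryDist`). Here `δ` is an infimum of signed distances to supporting hyperplanes. For
finitely many hyperplanes, `Ω` splits into cells according to the nearest one, with normal `ν i`;
each cell is preserved by the flow along the constant field `∇H(ν i)`, which carries its part of the
layer out through its own part of the boundary. The field has dual norm at most `1`, so its flux is
at most the anisotropic area of that part (`volume_sweep_le`), and these parts are disjoint. The
flux bound is proved by cutting the boundary into almost flat pieces, on each of which the sweep is
close to a linear map of known determinant.

For a torsion function, Hölder's inequality shows that `(∫ u)^(p-1)` bounds all the quotients
(`IsTorsionFunction.mem_upperBounds`), and an upper bound is all that the estimate uses. -/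

/-! ### Volume swept by an almost flat set. -/

section FlatPieces

variable {E : Type*} [NormedAddCommGroup E] [InnerProductSpace ℝ E] [FiniteDimensional ℝ E]

/-- The linear map which sends `ν` to `w` and `z ∈ νᗮ` to `z - ℓ(z) w` has determinant `⟨ν, w⟩`. -/
lemma det_shear {ν w : E} (hν : ‖ν‖ = 1) (ℓ : E →L[ℝ] ℝ) :
    ∃ L : E →L[ℝ] E, L.det = inner ℝ ν w ∧ ∀ x : E, L x =
      (x - inner ℝ ν x • ν) + (inner ℝ ν x - ℓ (x - inner ℝ ν x • ν)) • w := by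
  have hνν : inner ℝ ν ν = (1 : ℝ) := by simp [hν]
  -- `κ` kills `ν`, so the inner transvection has determinant `1`; the outer one has `1 + ⟨ν, w - ν⟩
  -- = ⟨ν, w⟩`.
  let κ : E →ₗ[ℝ] ℝ := (ℓ : E →ₗ[ℝ] ℝ) - ℓ ν • (innerSL ℝ ν : E →ₗ[ℝ] ℝ)
  let L : E →ₗ[ℝ] E := LinearMap.transvection (innerSL ℝ ν : E →ₗ[ℝ] ℝ) (w - ν) ∘ₗ
    LinearMap.transvection κ (-ν)
  refine ⟨L.toContinuousLinearMap, ?_, fun x => ?_⟩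
  · rw [ContinuousLinearMap.det, LinearMap.coe_toContinuousLinearMap, LinearMap.det_comp,
      LinearMap.transvection.det, LinearMap.transvection.det]
    simp [κ, inner_sub_right, hν]
  · simp only [LinearMap.coe_toContinuousLinearMap', L, κ, LinearMap.comp_apply,
      LinearMap.transvection.apply]
    simp [inner_add_right, inner_smul_right, hν]
    module

variable [MeasurableSpace E] [BorelSpace E]

/-- The orthogonal projection onto `νᗮ` does not increase the Euclidean Hausdorff measure. -/
lemma volume_image_orthogonalProjection_le {ν : E} (hν : ‖ν‖ = 1) (A : Set E) :
    volume ((ℝ ∙ ν)ᗮ.orthogonalProjectionOnto '' A) ≤ μHE[Module.finrank ℝ E - 1] A := by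
  have hrank : Module.finrank ℝ (ℝ ∙ ν)ᗮ = Module.finrank ℝ E - 1 := by
    have h := (ℝ ∙ ν).finrank_add_finrank_orthogonal
    rw [finrank_span_singleton (by rintro rfl; simp at hν)] at h
    omega
  rw [← InnerProductSpace.euclideanHausdorffMeasure_eq_volume, hrank,
    Measure.euclideanHausdorffMeasure_def, Measure.euclideanHausdorffMeasure_def,
    Measure.smul_apply, Measure.smul_apply]
  gcongr
  have hL : LipschitzWith 1 (ℝ ∙ ν)ᗮ.orthogonalProjectionOnto := by
    refine LipschitzWith.of_dist_le_mul fun x y => ?_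
    rw [dist_eq_norm, dist_eq_norm, ← map_sub]
    simpa using (ℝ ∙ ν)ᗮ.norm_orthogonalProjectionOnto_apply_le (x - y)
  simpa using hL.hausdorffMeasure_image_le (d := ((Module.finrank ℝ E - 1 : ℕ) : ℝ))
    (Nat.cast_nonneg _) A

/-- The volume of a right cylinder. -/
lemma volume_cylinder {ν : E} (hν : ‖ν‖ = 1) (B : Set (ℝ ∙ ν)ᗮ) (s t : ℝ) :
    volume {x : E | (ℝ ∙ ν)ᗮ.orthogonalProjectionOnto x ∈ B ∧ inner ℝ ν x ∈ Set.Ioc s t} =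
      ENNReal.ofReal (t - s) * volume B := by
  have hmp := (ℝ ∙ ν).measurePreserving_measurableEquivProd (0 : E)
  rw [InnerProductSpace.euclideanHausdorffMeasure_eq_volume] at hmp
  have hI : volume {z : ℝ ∙ ν | inner ℝ ν (z : E) ∈ Set.Ioc s t} = ENNReal.ofReal (t - s) := by
    have h1 := (LinearIsometryEquiv.toSpanUnitSingleton (𝕜 := ℝ) ν hν).measurePreserving
    rw [← h1.measure_preimage_emb (LinearIsometryEquiv.toSpanUnitSingleton (𝕜 := ℝ) ν
      hν).toHomeomorph.measurableEmbedding, ← Real.volume_Ioc]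
    congr 1
    ext r
    simp [inner_smul_right, hν]
  have hpre : {x : E | (ℝ ∙ ν)ᗮ.orthogonalProjectionOnto x ∈ B ∧ inner ℝ ν x ∈ Set.Ioc s t} =
      (ℝ ∙ ν).measurableEquivProd (0 : E) ⁻¹'
        ({z : ℝ ∙ ν | inner ℝ ν (z : E) ∈ Set.Ioc s t} ×ˢ B) := by
    ext x
    have : inner ℝ ν ((ℝ ∙ ν).starProjection x) = inner ℝ ν x := by
      rw [Submodule.starProjection_unit_singleton ℝ hν, inner_smul_right,
        real_inner_self_eq_norm_sq, hν]
      ring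
    simp [this, and_comm]
  rw [hpre, hmp.measure_preimage_equiv, Measure.volume_eq_prod, Measure.prod_prod, hI]

/-- A set which is almost contained in a hyperplane `νᗮ`, swept along a direction `w`, has
a volume controlled by its Hausdorff measure and `|⟨w, ν⟩|`. -/
lemma exists_flatness_volume_sweep_le {ν w : E} (hν : ‖ν‖ = 1) (ℓ : E →L[ℝ] ℝ) (hw : ℓ w = 1)
    {m : ℝ} (hm : |inner ℝ ν w| < m) :
    ∃ ε : ℝ, 0 < ε ∧ ∀ A : Set E,
      (∀ y ∈ A, ∀ y' ∈ A, |inner ℝ ν (y - y')| ≤ ε * ‖y - y'‖) → ∀ s t : ℝ,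
      volume {x : E | ℓ x ∈ Set.Ioc s t ∧ ∃ ρ : ℝ, x + ρ • w ∈ A} ≤
        ENNReal.ofReal m * (ENNReal.ofReal (t - s) * μHE[Module.finrank ℝ E - 1] A) := by
  obtain ⟨L, hdet, hL⟩ := det_shear (w := w) hν ℓ
  have hνν : inner ℝ ν ν = (1 : ℝ) := by simp [hν]
  have hm0 : 0 < m := (abs_nonneg _).trans_lt hm
  -- Every map that is `δ`-close to `L` expands volumes by a factor at most `m`, since `|det L| <
  -- m`.
  have key := addHaar_image_le_mul_of_det_lt (volume : Measure E) L (m := m.toNNReal)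
    (by rw [hdet]; exact (ENNReal.ofReal_lt_ofReal_iff hm0).2 hm)
  obtain ⟨δ, hδ, hδ0⟩ := (key.and self_mem_nhdsWithin).exists
  set c : ℝ := ‖ν - ℓ ν • w‖ with hc
  have hδ0' : (0 : ℝ) < δ := hδ0
  have hc0 : 0 ≤ c := norm_nonneg _
  -- The bound `1/2` makes `A` a graph over `νᗮ` of slope at most `2ε`; the other bound gives `2εc ≤
  -- δ`, the error allowed in `key`.
  refine ⟨min (1 / 2) (δ / (2 * (c + 1))), by positivity, fun A hA s t => ?_⟩
  set ε := min (1 / 2) ((δ : ℝ) / (2 * (c + 1))) with hε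
  have hε0 : 0 < ε := by positivity
  have hε1 : ε ≤ 1 / 2 := min_le_left _ _
  have hε2 : 2 * ε * c ≤ δ := by
    have h1 : ε ≤ δ / (2 * (c + 1)) := min_le_right _ _
    rw [le_div_iff₀ (by positivity)] at h1
    nlinarith
  set π := (ℝ ∙ ν)ᗮ.orthogonalProjectionOnto with hπ
  have hπx : ∀ x : E, (π x : E) = x - inner ℝ ν x • ν := by
    intro x
    rw [← Submodule.starProjection_unit_singleton ℝ hν]
    exact Submodule.starProjection_orthogonal_val x
  have hflat : ∀ y ∈ A, ∀ y' ∈ A, |inner ℝ ν (y - y')| ≤ 2 * ε * ‖π (y - y')‖ := by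
    intro y hy y' hy'
    have h1 := hA y hy y' hy'
    have h2 : ‖y - y'‖ ≤ ‖π (y - y')‖ + |inner ℝ ν (y - y')| := by
      have : y - y' = (π (y - y') : E) + inner ℝ ν (y - y') • ν := by rw [hπx]; abel
      calc ‖y - y'‖ = ‖(π (y - y') : E) + inner ℝ ν (y - y') • ν‖ := by rw [← this]
        _ ≤ _ := (norm_add_le _ _).trans (by simp [norm_smul, hν])
    have h3 := norm_nonneg (π (y - y'))
    nlinarith [abs_nonneg (inner ℝ ν (y - y'))]
  have hinj : ∀ y ∈ A, ∀ y' ∈ A, π y = π y' → y = y' := by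
    intro y hy y' hy' h
    have h0 : π (y - y') = 0 := by rw [map_sub, h, sub_self]
    have h1 := hflat y hy y' hy'
    rw [h0, norm_zero, mul_zero] at h1
    have h2 : inner ℝ ν (y - y') = 0 := abs_eq_zero.1 (le_antisymm h1 (abs_nonneg _))
    have h3 := hπx (y - y')
    rw [h0, h2] at h3
    simpa [sub_eq_zero, eq_comm] using h3
  choose! g hg using fun (z : (ℝ ∙ ν)ᗮ) (hz : z ∈ π '' A) => hz
  set T : Set E := {x : E | π x ∈ π '' A ∧ inner ℝ ν x ∈ Set.Ioc s t} with hT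
  -- `g` parametrizes `A` by its projection. `f x` is the point at level `ℓ = ⟨ν, x⟩` on the line
  -- through `g (π x)` with direction `w`; for a flat `A` it would have linear part `L`.
  set f : E → E := fun x => g (π x) + (inner ℝ ν x - ℓ (g (π x))) • w with hf
  have happ : ApproximatesLinearOn f L T δ := by
    intro x hx x' hx'
    obtain ⟨hy, hyx⟩ := hg _ hx.1
    obtain ⟨hy', hyx'⟩ := hg _ hx'.1
    set y := g (π x)
    set y' := g (π x')
    have hd : π (y - y') = π (x - x') := by rw [map_sub, map_sub, hyx, hyx']
    have h1 : y - y' = (x - x' - inner ℝ ν (x - x') • ν) + inner ℝ ν (y - y') • ν := by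
      rw [← hπx, ← hd, hπx]; abel
    have h2 : f x - f x' - L (x - x') = inner ℝ ν (y - y') • (ν - ℓ ν • w) := by
      have h3 : f x - f x' = (y - y') + (inner ℝ ν (x - x') - ℓ (y - y')) • w := by
        simp only [hf, inner_sub_right, map_sub]
        module
      rw [h3, hL]
      set a := inner ℝ ν (y - y')
      rw [h1, map_add, map_smul, smul_eq_mul]
      module
    rw [h2, norm_smul, Real.norm_eq_abs]
    have h4 := hflat y hy y' hy'
    rw [hd] at h4
    have h5 : ‖π (x - x')‖ ≤ ‖x - x'‖ :=
      (ℝ ∙ ν)ᗮ.norm_orthogonalProjectionOnto_apply_le (x - x')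
    calc |inner ℝ ν (y - y')| * ‖ν - ℓ ν • w‖ ≤ (2 * ε * ‖x - x'‖) * c := by
          gcongr; exact h4.trans (by gcongr)
      _ = 2 * ε * c * ‖x - x'‖ := by ring
      _ ≤ δ * ‖x - x'‖ := by gcongr
  have hsub : {x : E | ℓ x ∈ Set.Ioc s t ∧ ∃ ρ : ℝ, x + ρ • w ∈ A} ⊆ f '' T := by
    rintro e ⟨he, ρ, hρ⟩
    have hνπ : inner ℝ ν ((π (e + ρ • w) : (ℝ ∙ ν)ᗮ) : E) = 0 := by
      rw [hπx, inner_sub_right, inner_smul_right, hνν]; ring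
    have hππ : π ((π (e + ρ • w) : (ℝ ∙ ν)ᗮ) + ℓ e • ν) = π (e + ρ • w) := by
      apply Subtype.ext
      rw [hπx, inner_add_right, hνπ, inner_smul_right, hνν]
      simp
    refine ⟨(π (e + ρ • w) : (ℝ ∙ ν)ᗮ) + ℓ e • ν, ⟨?_, ?_⟩, ?_⟩
    · rw [hππ]; exact ⟨_, hρ, rfl⟩
    · rw [inner_add_right, hνπ, inner_smul_right, hνν]; simpa using he
    · have hgy : g (π (e + ρ • w)) = e + ρ • w := by
        obtain ⟨h1, h2⟩ := hg (π (e + ρ • w)) ⟨_, hρ, rfl⟩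
        exact hinj _ h1 _ hρ h2
      simp only [hf, hππ, hgy]
      rw [inner_add_right, hνπ, inner_smul_right, hνν, map_add, map_smul, hw]
      simp only [smul_eq_mul]
      module
  calc volume {x : E | ℓ x ∈ Set.Ioc s t ∧ ∃ ρ : ℝ, x + ρ • w ∈ A}
      ≤ volume (f '' T) := measure_mono hsub
    _ ≤ m.toNNReal * volume T := hδ T f happ
    _ = ENNReal.ofReal m * (ENNReal.ofReal (t - s) * volume (π '' A)) := by
        rw [hT, volume_cylinder hν]; rfl
    _ ≤ _ := by gcongr; exact volume_image_orthogonalProjection_le hν A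

end FlatPieces

/-! ### The norm `H` and its gradient. -/

section AnisotropicNorm

variable {n : ℕ} {H : EuclideanSpace ℝ (Fin n) → ℝ}

namespace IsAnisotropicNorm

lemma map_zero (hH : IsAnisotropicNorm H) : H 0 = 0 := by
  simpa using hH.map_smul 0 0

lemma map_neg (hH : IsAnisotropicNorm H) (ξ : EuclideanSpace ℝ (Fin n)) : H (-ξ) = H ξ := by
  simpa using hH.map_smul (-1) ξ

lemma pos (hH : IsAnisotropicNorm H) {ξ : EuclideanSpace ℝ (Fin n)} (hξ : ξ ≠ 0) : 0 < H ξ := by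
  obtain ⟨α, β, hα, -, h⟩ := hH.bounds
  have := norm_pos_iff.2 hξ
  exact (by positivity : 0 < α * ‖ξ‖).trans_le (h ξ).1

lemma nonneg (hH : IsAnisotropicNorm H) (ξ : EuclideanSpace ℝ (Fin n)) : 0 ≤ H ξ := by
  rcases eq_or_ne ξ 0 with rfl | h
  · exact hH.map_zero.ge
  · exact (hH.pos h).le

lemma add_le (hH : IsAnisotropicNorm H) (ξ η : EuclideanSpace ℝ (Fin n)) :
    H (ξ + η) ≤ H ξ + H η := by
  have h := hH.convexOn.2 (Set.mem_univ ((2 : ℝ) • ξ)) (Set.mem_univ ((2 : ℝ) • η))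
    (by norm_num : (0 : ℝ) ≤ 1 / 2) (by norm_num : (0 : ℝ) ≤ 1 / 2) (by norm_num)
  rw [hH.map_smul, hH.map_smul, smul_smul, smul_smul] at h
  norm_num at h
  linarith

lemma le_add_sub (hH : IsAnisotropicNorm H) (ξ η : EuclideanSpace ℝ (Fin n)) :
    H ξ ≤ H η + H (ξ - η) := by
  simpa using hH.add_le η (ξ - η)

lemma continuous (hH : IsAnisotropicNorm H) : Continuous H := by
  obtain ⟨α, β, hα, hαβ, h⟩ := hH.bounds
  refine (LipschitzWith.of_dist_le_mul (K := β.toNNReal) fun x y => ?_).continuous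
  rw [Real.dist_eq, dist_eq_norm, Real.coe_toNNReal _ (hα.le.trans hαβ), abs_le]
  have h1 := hH.le_add_sub x y
  have h2 := hH.le_add_sub y x
  have h3 := (h (x - y)).2
  have h4 := (h (y - x)).2
  rw [norm_sub_rev] at h4
  constructor <;> linarith

lemma differentiableAt (hH : IsAnisotropicNorm H) {ν : EuclideanSpace ℝ (Fin n)} (hν : ν ≠ 0) :
    DifferentiableAt ℝ H ν :=
  ((hH.contDiffOn.differentiableOn (by simp)) ν hν).differentiableAt
    (isOpen_compl_singleton.mem_nhds hν)

lemma hasDerivAt_line (hH : IsAnisotropicNorm H) {ν : EuclideanSpace ℝ (Fin n)} (hν : ν ≠ 0)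
    (ξ : EuclideanSpace ℝ (Fin n)) :
    HasDerivAt (fun t : ℝ => H (ν + t • ξ)) (inner ℝ (gradient H ν) ξ) 0 := by
  have h := (hH.differentiableAt hν).hasGradientAt.hasFDerivAt
  have h1 : HasDerivAt (fun t : ℝ => ν + t • ξ) ξ 0 := by
    simpa using ((hasDerivAt_id (0 : ℝ)).smul_const ξ).const_add ν
  have h2 : HasFDerivAt H (InnerProductSpace.toDual ℝ _ (gradient H ν)) (ν + (0 : ℝ) • ξ) := by
    simpa using h
  simpa [Function.comp_def] using h2.comp_hasDerivAt 0 h1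

/-- The gradient of `H` lies in the unit ball of the dual norm. -/
lemma inner_gradient_le (hH : IsAnisotropicNorm H) {ν : EuclideanSpace ℝ (Fin n)} (hν : ν ≠ 0)
    (ξ : EuclideanSpace ℝ (Fin n)) : inner ℝ (gradient H ν) ξ ≤ H ξ := by
  have h := (hH.hasDerivAt_line hν ξ).tendsto_slope_zero_right
  refine le_of_tendsto h ?_
  filter_upwards [self_mem_nhdsWithin] with t (ht : 0 < t)
  have h1 := hH.add_le ν (t • ξ)
  rw [hH.map_smul, abs_of_pos ht] at h1
  simp only [zero_add, zero_smul, add_zero, smul_eq_mul]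
  rw [inv_mul_le_iff₀ ht]
  linarith

/-- Euler's identity: by homogeneity the difference quotients along the ray through `ν` equal `H ν`.
Moving along `gradient H ν` thus changes `⟨ν, ·⟩ / H ν` at unit rate. -/
lemma inner_gradient_self (hH : IsAnisotropicNorm H) {ν : EuclideanSpace ℝ (Fin n)} (hν : ν ≠ 0) :
    inner ℝ (gradient H ν) ν = H ν := by
  refine le_antisymm (hH.inner_gradient_le hν ν) ?_
  have h' := (hH.hasDerivAt_line hν ν).tendsto_slope_zero_right
  refine ge_of_tendsto h' ?_
  filter_upwards [self_mem_nhdsWithin] with t (ht : 0 < t)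
  have h1 : ν + t • ν = (1 + t) • ν := by module
  simp only [zero_add, zero_smul, add_zero, smul_eq_mul]
  rw [h1, hH.map_smul, abs_of_pos (by linarith), le_inv_mul_iff₀ ht]
  linarith

lemma abs_inner_le (hH : IsAnisotropicNorm H) {w : EuclideanSpace ℝ (Fin n)}
    (hw : ∀ ξ, inner ℝ w ξ ≤ H ξ) (ξ : EuclideanSpace ℝ (Fin n)) : |inner ℝ w ξ| ≤ H ξ := by
  refine abs_le.2 ⟨?_, hw ξ⟩
  have h := hw (-ξ)
  rw [inner_neg_right, hH.map_neg] at h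
  linarith

end IsAnisotropicNorm

end AnisotropicNorm

/-! ### Outer normals of a convex set. -/

section Normals

variable {n : ℕ} {Ω : Set (EuclideanSpace ℝ (Fin n))}

lemma exists_isOuterUnitNormal (hopen : IsOpen Ω) (hconv : Convex ℝ Ω) (hne : Ω.Nonempty)
    {x : EuclideanSpace ℝ (Fin n)} (hx : x ∉ Ω) : ∃ ν, IsOuterUnitNormal Ω x ν := by
  obtain ⟨f, hf⟩ := geometric_hahn_banach_open_point hconv hopen hx
  set v := (InnerProductSpace.toDual ℝ (EuclideanSpace ℝ (Fin n))).symm f with hv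
  have hfv : ∀ y, f y = inner ℝ v y := fun y => by simp [hv]
  have hv0 : v ≠ 0 := by
    rintro h
    obtain ⟨y, hy⟩ := hne
    have := hf y hy
    simp [hfv, h] at this
  refine ⟨‖v‖⁻¹ • v, norm_smul_inv_norm hv0, fun y hy => ?_⟩
  have h := hf y hy
  rw [hfv, hfv] at h
  rw [inner_smul_left, inner_sub_right]
  exact mul_nonpos_of_nonneg_of_nonpos (by simp) (by linarith)

lemma IsOuterUnitNormal.of_mem_closure {x ν y : EuclideanSpace ℝ (Fin n)}
    (h : IsOuterUnitNormal Ω x ν) (hy : y ∈ closure Ω) : inner ℝ ν (y - x) ≤ 0 := by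
  have hc : IsClosed {y | inner ℝ ν (y - x) ≤ (0 : ℝ)} :=
    isClosed_le (by fun_prop) continuous_const
  exact closure_minimal (fun y hy => h.2 y hy) hc hy

lemma isOuterUnitNormal_outerUnitNormal (hopen : IsOpen Ω) (hconv : Convex ℝ Ω)
    (hne : Ω.Nonempty) {x : EuclideanSpace ℝ (Fin n)} (hx : x ∈ frontier Ω) :
    IsOuterUnitNormal Ω x (outerUnitNormal Ω x) := by
  have hx' : x ∉ Ω := by
    rw [hopen.frontier_eq] at hx
    exact hx.2
  have h := exists_isOuterUnitNormal hopen hconv hne hx'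
  rw [outerUnitNormal, dif_pos h]
  exact h.choose_spec

/-- The boundary points of `Ω` which have an outer unit normal at distance at most `ε` from `ν`. -/
def normalPatch (Ω : Set (EuclideanSpace ℝ (Fin n))) (ν : EuclideanSpace ℝ (Fin n)) (ε : ℝ) :
    Set (EuclideanSpace ℝ (Fin n)) :=
  {x ∈ frontier Ω | ∃ ν', IsOuterUnitNormal Ω x ν' ∧ ‖ν' - ν‖ ≤ ε}

/-- The patch is the projection of a compact set of pairs (point, normal). Allowing any normal at
`x`, not only the chosen one, is what makes it closed and hence measurable. -/
lemma isClosed_normalPatch (hbdd : Bornology.IsBounded Ω) (ν : EuclideanSpace ℝ (Fin n)) (ε : ℝ) :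
    IsClosed (normalPatch Ω ν ε) := by
  have hK : IsCompact (frontier Ω) :=
    Metric.isCompact_of_isClosed_isBounded isClosed_frontier
      (hbdd.closure.subset frontier_subset_closure)
  have hc : IsClosed {q : EuclideanSpace ℝ (Fin n) × EuclideanSpace ℝ (Fin n) |
      IsOuterUnitNormal Ω q.1 q.2} := by
    have : {q : EuclideanSpace ℝ (Fin n) × EuclideanSpace ℝ (Fin n) |
        IsOuterUnitNormal Ω q.1 q.2} = {q | ‖q.2‖ = 1} ∩
          ⋂ y ∈ Ω, {q | inner ℝ q.2 (y - q.1) ≤ 0} := by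
      ext q
      simp [IsOuterUnitNormal]
    rw [this]
    refine (isClosed_eq (by fun_prop) continuous_const).inter
      (isClosed_biInter fun y _ => isClosed_le (by fun_prop) continuous_const)
  have h := ((hK.prod (isCompact_closedBall ν ε)).inter_right hc).image continuous_fst
  convert h.isClosed using 1
  ext x
  simp only [normalPatch, Set.mem_image, Set.mem_inter_iff, Set.mem_prod, Prod.exists,
    Metric.mem_closedBall, dist_eq_norm, Set.mem_ofPred_eq]
  constructor
  · rintro ⟨hx, ν', h1, h2⟩
    exact ⟨x, ν', ⟨⟨hx, h2⟩, h1⟩, rfl⟩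
  · rintro ⟨y, ν', ⟨⟨hx, h2⟩, h1⟩, rfl⟩
    exact ⟨hx, ν', h1, h2⟩

/-- The part of the boundary of a convex set with normals close to `ν` is almost flat. -/
lemma abs_inner_sub_le_of_mem_normalPatch {ν y y' : EuclideanSpace ℝ (Fin n)} {ε : ℝ}
    (hy : y ∈ normalPatch Ω ν ε) (hy' : y' ∈ normalPatch Ω ν ε) :
    |inner ℝ ν (y - y')| ≤ ε * ‖y - y'‖ := by
  have main : ∀ {y y' : EuclideanSpace ℝ (Fin n)}, y ∈ normalPatch Ω ν ε →
      y' ∈ normalPatch Ω ν ε → inner ℝ ν (y - y') ≤ ε * ‖y - y'‖ := by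
    rintro y y' ⟨hy, -⟩ ⟨-, ν', h1, h2⟩
    have h3 := h1.of_mem_closure (frontier_subset_closure hy)
    have h4 : inner ℝ ν (y - y') = inner ℝ ν' (y - y') - inner ℝ (ν' - ν) (y - y') := by
      rw [inner_sub_left]; ring
    have h5 := (abs_le.1 (abs_real_inner_le_norm (ν' - ν) (y - y'))).1
    nlinarith [norm_nonneg (y - y')]
  refine abs_le.2 ⟨?_, main hy hy'⟩
  have h := main hy' hy
  rw [← neg_sub y y', inner_neg_right, norm_neg] at h
  linarith

end Normals

/-! ### Flux of a constant field through the boundary. -/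

section Flux

variable {n : ℕ} {H : EuclideanSpace ℝ (Fin n) → ℝ} {Ω : Set (EuclideanSpace ℝ (Fin n))}

/-- Flux of a constant field `w` of dual norm at most `1` through a part of the boundary,
up to a small error. -/
lemma volume_sweep_le_add (hH : IsAnisotropicNorm H) (hne : Ω.Nonempty) (hopen : IsOpen Ω)
    (hconv : Convex ℝ Ω) (hbdd : Bornology.IsBounded Ω) {w : EuclideanSpace ℝ (Fin n)}
    (hw : ∀ ξ, inner ℝ w ξ ≤ H ξ) (ℓ : EuclideanSpace ℝ (Fin n) →L[ℝ] ℝ) (hℓ : ℓ w = 1)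
    {S : Set (EuclideanSpace ℝ (Fin n))} (hS : MeasurableSet S) (hSΩ : S ⊆ frontier Ω)
    (s t : ℝ) {η : ℝ} (hη : 0 < η) :
    volume {x | ℓ x ∈ Set.Ioc s t ∧ ∃ ρ : ℝ, x + ρ • w ∈ S} ≤
      ENNReal.ofReal (t - s) *
        ∫⁻ x in S, ENNReal.ofReal (H (outerUnitNormal Ω x) + η) ∂μHE[n - 1] := by
  obtain ⟨α, β, hα, hαβ, hβ⟩ := hH.bounds
  have hβ0 : 0 < β := hα.trans_le hαβ
  have hflat : ∀ ν : EuclideanSpace ℝ (Fin n), ‖ν‖ = 1 → ∃ ε : ℝ, 0 < ε ∧ ε ≤ η / (2 * β) ∧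
      ∀ A : Set (EuclideanSpace ℝ (Fin n)), A ⊆ normalPatch Ω ν ε →
      volume {x | ℓ x ∈ Set.Ioc s t ∧ ∃ ρ : ℝ, x + ρ • w ∈ A} ≤
        ENNReal.ofReal (H ν + η / 2) * (ENNReal.ofReal (t - s) * μHE[n - 1] A) := by
    intro ν hν
    obtain ⟨ε, hε, h⟩ := exists_flatness_volume_sweep_le hν ℓ hℓ (m := H ν + η / 2)
      (by rw [real_inner_comm]; linarith [hH.abs_inner_le hw ν])
    refine ⟨min ε (η / (2 * β)), by positivity, min_le_right _ _, fun A hA => ?_⟩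
    have h1 := h A (fun y hy y' hy' =>
      (abs_inner_sub_le_of_mem_normalPatch (hA hy) (hA hy')).trans
        (by gcongr; exact min_le_left _ _)) s t
    simpa using h1
  choose! ε hε0 hεη hε using hflat
  obtain ⟨C, hCs, hC⟩ := (isCompact_sphere (0 : EuclideanSpace ℝ (Fin n)) 1).elim_nhds_subcover
    (fun ν => Metric.ball ν (ε ν)) (fun ν hν => Metric.ball_mem_nhds _ (hε0 ν (by simpa using hν)))
  have main : ∀ D : Finset (EuclideanSpace ℝ (Fin n)), (∀ ν ∈ D, ‖ν‖ = 1) →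
      ∀ S : Set (EuclideanSpace ℝ (Fin n)), MeasurableSet S → S ⊆ frontier Ω →
      (∀ x ∈ S, ∃ ν ∈ D, ‖outerUnitNormal Ω x - ν‖ ≤ ε ν) →
      volume {x | ℓ x ∈ Set.Ioc s t ∧ ∃ ρ : ℝ, x + ρ • w ∈ S} ≤ ENNReal.ofReal (t - s) *
        ∫⁻ x in S, ENNReal.ofReal (H (outerUnitNormal Ω x) + η) ∂μHE[n - 1] := by
    intro D
    -- At a corner some normal may be close to `a` while the chosen one is close to another `ν`.
    -- Removing the directions in increasing order of `H` ensures `H a ≤ H ν`, so the estimate by `H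
    -- a` remains valid there.
    induction D using Finset.induction_on_min_value H with
    | empty =>
      intro _ S _ _ hcov
      have : S = ∅ := Set.eq_empty_of_forall_notMem fun x hx => by simpa using hcov x hx
      simp [this]
    | insert a D _ hmin ih =>
      intro hD S hS hSΩ hcov
      have ha : ‖a‖ = 1 := hD a (Finset.mem_insert_self _ _)
      set T := normalPatch Ω a (ε a)
      have hT : MeasurableSet T := (isClosed_normalPatch hbdd a (ε a)).measurableSet
      have h1 : volume {x | ℓ x ∈ Set.Ioc s t ∧ ∃ ρ : ℝ, x + ρ • w ∈ S ∩ T} ≤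
          ENNReal.ofReal (t - s) *
            ∫⁻ x in S ∩ T, ENNReal.ofReal (H (outerUnitNormal Ω x) + η) ∂μHE[n - 1] := by
        refine (hε a ha _ Set.inter_subset_right).trans ?_
        rw [mul_left_comm, ← setLIntegral_const]
        gcongr ENNReal.ofReal (t - s) * ?_
        refine setLIntegral_mono' (hS.inter hT) fun x hx => ENNReal.ofReal_le_ofReal ?_
        obtain ⟨ν, hν, hxν⟩ := hcov x hx.1
        have h2 : H a ≤ H ν := by
          rcases Finset.mem_insert.1 hν with rfl | h
          · exact le_rfl
          · exact hmin ν h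
        have h3 := hH.le_add_sub ν (outerUnitNormal Ω x)
        have h4 : H (ν - outerUnitNormal Ω x) ≤ η / 2 := by
          refine (hβ _).2.trans ?_
          rw [norm_sub_rev]
          calc β * ‖outerUnitNormal Ω x - ν‖ ≤ β * (η / (2 * β)) := by
                gcongr; exact hxν.trans (hεη ν (hD ν hν))
            _ = η / 2 := by field_simp
        linarith
      have h2 := ih (fun ν hν => hD ν (Finset.mem_insert_of_mem hν)) (S \ T) (hS.diff hT)
        (Set.sdiff_subset.trans hSΩ) (fun x hx => by
          obtain ⟨ν, hν, hxν⟩ := hcov x hx.1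
          rcases Finset.mem_insert.1 hν with rfl | h
          · exact absurd ⟨hSΩ hx.1, _,
              isOuterUnitNormal_outerUnitNormal hopen hconv hne (hSΩ hx.1), hxν⟩ hx.2
          · exact ⟨ν, h, hxν⟩)
      rw [← lintegral_inter_add_sdiff _ S hT, mul_add]
      refine (measure_mono ?_).trans ((measure_union_le _ _).trans (add_le_add h1 h2))
      rintro x ⟨hx, ρ, hρ⟩
      by_cases h : x + ρ • w ∈ T
      · exact Or.inl ⟨hx, ρ, hρ, h⟩
      · exact Or.inr ⟨hx, ρ, hρ, h⟩
  refine main C (fun ν hν => by simpa using hCs ν hν) S hS hSΩ fun x hx => ?_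
  have h1 := isOuterUnitNormal_outerUnitNormal hopen hconv hne (hSΩ hx)
  have h2 := hC (show outerUnitNormal Ω x ∈ Metric.sphere 0 1 by simpa using h1.1)
  simp only [Set.mem_iUnion, Metric.mem_ball, dist_eq_norm] at h2
  obtain ⟨ν, hν, h3⟩ := h2
  exact ⟨ν, hν, h3.le⟩

/-- `H ≥ α` on unit vectors. Finiteness lets the error `η` times the area vanish as `η → 0`. -/
lemma measure_frontier_lt_top (hH : IsAnisotropicNorm H) (hne : Ω.Nonempty) (hopen : IsOpen Ω)
    (hconv : Convex ℝ Ω) (hP : anisotropicPerimeter H Ω ≠ ⊤) :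
    (μHE[n - 1] : Measure (EuclideanSpace ℝ (Fin n))) (frontier Ω) < ⊤ := by
  obtain ⟨α, β, hα, -, h⟩ := hH.bounds
  have h1 : ENNReal.ofReal α * (μHE[n - 1] : Measure (EuclideanSpace ℝ (Fin n))) (frontier Ω) ≤
      anisotropicPerimeter H Ω := by
    rw [← setLIntegral_const]
    refine setLIntegral_mono' isClosed_frontier.measurableSet fun x hx =>
      ENNReal.ofReal_le_ofReal ?_
    have h2 := (h (outerUnitNormal Ω x)).1
    rwa [(isOuterUnitNormal_outerUnitNormal hopen hconv hne hx).1, mul_one] at h2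
  by_contra htop
  rw [not_lt_top_iff.1 htop, ENNReal.mul_top (by simpa using hα), top_le_iff] at h1
  exact hP h1

/-- Flux of a constant field `w` of dual norm at most `1` through a part of the boundary. -/
lemma volume_sweep_le (hH : IsAnisotropicNorm H) (hne : Ω.Nonempty) (hopen : IsOpen Ω)
    (hconv : Convex ℝ Ω) (hbdd : Bornology.IsBounded Ω) (hP : anisotropicPerimeter H Ω ≠ ⊤)
    {w : EuclideanSpace ℝ (Fin n)}
    (hw : ∀ ξ, inner ℝ w ξ ≤ H ξ) (ℓ : EuclideanSpace ℝ (Fin n) →L[ℝ] ℝ) (hℓ : ℓ w = 1)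
    {S : Set (EuclideanSpace ℝ (Fin n))} (hS : MeasurableSet S) (hSΩ : S ⊆ frontier Ω)
    (s t : ℝ) :
    volume {x | ℓ x ∈ Set.Ioc s t ∧ ∃ ρ : ℝ, x + ρ • w ∈ S} ≤
      ENNReal.ofReal (t - s) *
        ∫⁻ x in S, ENNReal.ofReal (H (outerUnitNormal Ω x)) ∂μHE[n - 1] := by
  have hfin : (μHE[n - 1] : Measure (EuclideanSpace ℝ (Fin n))) S ≠ ⊤ :=
    ((measure_mono hSΩ).trans_lt (measure_frontier_lt_top hH hne hopen hconv hP)).ne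
  set I := ∫⁻ x in S, ENNReal.ofReal (H (outerUnitNormal Ω x)) ∂μHE[n - 1]
  have h1 : ∀ η : ℝ, 0 < η → volume {x | ℓ x ∈ Set.Ioc s t ∧ ∃ ρ : ℝ, x + ρ • w ∈ S} ≤
      ENNReal.ofReal (t - s) * (I + ENNReal.ofReal η *
        (μHE[n - 1] : Measure (EuclideanSpace ℝ (Fin n))) S) := by
    intro η hη
    refine (volume_sweep_le_add hH hne hopen hconv hbdd hw ℓ hℓ hS hSΩ s t hη).trans ?_
    gcongr
    rw [← setLIntegral_const, ← lintegral_add_right _ measurable_const]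
    gcongr
    exact ENNReal.ofReal_add_le
  have h2 : Tendsto (fun η : ℝ => ENNReal.ofReal (t - s) * (I + ENNReal.ofReal η *
        (μHE[n - 1] : Measure (EuclideanSpace ℝ (Fin n))) S)) (𝓝[>] 0)
      (𝓝 (ENNReal.ofReal (t - s) * (I + ENNReal.ofReal 0 *
        (μHE[n - 1] : Measure (EuclideanSpace ℝ (Fin n))) S))) := by
    refine ENNReal.Tendsto.const_mul ?_ (Or.inr ENNReal.ofReal_ne_top)
    refine Tendsto.const_add _ (ENNReal.Tendsto.mul_const ?_ (Or.inr hfin))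
    exact (ENNReal.continuous_ofReal.tendsto 0).mono_left nhdsWithin_le_nhds
  simp only [ENNReal.ofReal_zero, zero_mul, add_zero] at h2
  refine ge_of_tendsto h2 ?_
  filter_upwards [self_mem_nhdsWithin] with η hη using h1 η hη

end Flux

/-! ### Distance to the boundary and volume of its layers. -/

section Layers

variable {n : ℕ} {H : EuclideanSpace ℝ (Fin n) → ℝ} {Ω : Set (EuclideanSpace ℝ (Fin n))}

/-- A half-line is connected and leaves every bounded set. The sign of `ρ` matters: cells are
preserved only by the forward flow. -/
lemma exists_add_smul_mem_frontier {E : Type*} [NormedAddCommGroup E] [NormedSpace ℝ E]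
    {Ω : Set E} (hbdd : Bornology.IsBounded Ω) {x w : E} (hx : x ∈ Ω) (hw : w ≠ 0) :
    ∃ ρ : ℝ, 0 ≤ ρ ∧ x + ρ • w ∈ frontier Ω := by
  obtain ⟨R, hR⟩ := hbdd.exists_norm_le
  have hR0 : 0 ≤ R := (norm_nonneg x).trans (hR x hx)
  have hw' : 0 < ‖w‖ := norm_pos_iff.2 hw
  set r : ℝ := (2 * R + 1) / ‖w‖ with hr
  have hr0 : 0 ≤ r := by positivity
  have hpre : IsPreconnected ((fun ρ : ℝ => x + ρ • w) '' Set.Ici 0) :=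
    isPreconnected_Ici.image _ (by fun_prop)
  have hout : x + r • w ∉ Ω := by
    intro h
    have h1 := hR _ h
    have h2 : ‖r • w‖ = 2 * R + 1 := by
      rw [norm_smul, Real.norm_of_nonneg hr0, hr]; field_simp
    have h3 : ‖r • w‖ ≤ ‖x + r • w‖ + ‖x‖ := by
      simpa using norm_sub_le (x + r • w) x
    linarith [hR x hx]
  by_contra! hfr
  have hcov : ∀ ρ : ℝ, 0 ≤ ρ → x + ρ • w ∈ closure Ω → x + ρ • w ∈ interior Ω := by
    intro ρ hρ h
    by_contra hi
    exact hfr ρ hρ ⟨h, hi⟩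
  obtain ⟨y, -, hy1, hy2⟩ := hpre (interior Ω) (closure Ω)ᶜ isOpen_interior
    isClosed_closure.isOpen_compl
    (by
      rintro _ ⟨ρ, hρ, rfl⟩
      exact (em (x + ρ • w ∈ closure Ω)).imp (hcov ρ hρ) id)
    ⟨x + (0 : ℝ) • w, ⟨0, by simp, rfl⟩, hcov 0 le_rfl (by simpa using subset_closure hx)⟩
    ⟨x + r • w, ⟨r, hr0, rfl⟩, fun h => hout (interior_subset (hcov r hr0 h))⟩
  exact hy2 (subset_closure (interior_subset hy1))

/-- The anisotropic distance from `x` to the hyperplane `⟨ν, y⟩ = c`, with a sign. -/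
noncomputable def hyperplaneDist (H : EuclideanSpace ℝ (Fin n) → ℝ)
    (ν : EuclideanSpace ℝ (Fin n)) (c : ℝ) (x : EuclideanSpace ℝ (Fin n)) : ℝ :=
  (c - inner ℝ ν x) / H ν

lemma continuous_hyperplaneDist (ν : EuclideanSpace ℝ (Fin n)) (c : ℝ) :
    Continuous (hyperplaneDist H ν c) := by
  unfold hyperplaneDist
  fun_prop

lemma IsAnisotropicNorm.abs_hyperplaneDist_sub_le (hH : IsAnisotropicNorm H)
    {w : EuclideanSpace ℝ (Fin n)} (hw : ∀ ξ, inner ℝ w ξ ≤ H ξ)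
    {ν : EuclideanSpace ℝ (Fin n)} (hν : ν ≠ 0) (c r : ℝ) (x : EuclideanSpace ℝ (Fin n)) :
    |hyperplaneDist H ν c (x + r • w) - hyperplaneDist H ν c x| ≤ |r| := by
  have h := hH.abs_inner_le hw ν
  have hp := hH.pos hν
  have : hyperplaneDist H ν c (x + r • w) - hyperplaneDist H ν c x =
      -(r * (inner ℝ w ν / H ν)) := by
    rw [hyperplaneDist, hyperplaneDist, inner_add_right, inner_smul_right, real_inner_comm w]
    ring
  rw [this, abs_neg, abs_mul, abs_div, abs_of_pos hp]
  exact mul_le_of_le_one_right (abs_nonneg _) ((div_le_one hp).2 h)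

/-- The layers of the distance to finitely many hyperplanes. -/
lemma volume_layer_min_le (hH : IsAnisotropicNorm H) (hne : Ω.Nonempty) (hopen : IsOpen Ω)
    (hconv : Convex ℝ Ω) (hbdd : Bornology.IsBounded Ω) (hP : anisotropicPerimeter H Ω ≠ ⊤)
    {ν : ℕ → EuclideanSpace ℝ (Fin n)} (hν : ∀ i, ν i ≠ 0) (c : ℕ → ℝ) (N : ℕ) (s t : ℝ) :
    volume {x ∈ Ω | ∃ i < N, hyperplaneDist H (ν i) (c i) x ∈ Set.Ico s t ∧
      ∀ j < N, hyperplaneDist H (ν i) (c i) x ≤ hyperplaneDist H (ν j) (c j) x} ≤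
      ENNReal.ofReal (t - s) * anisotropicPerimeter H Ω := by
  set a : ℕ → EuclideanSpace ℝ (Fin n) → ℝ := fun i => hyperplaneDist H (ν i) (c i) with ha
  have hac : ∀ i, Continuous (a i) := fun i => continuous_hyperplaneDist _ _
  set w : ℕ → EuclideanSpace ℝ (Fin n) := fun i => gradient H (ν i) with hw
  have hwW : ∀ i ξ, inner ℝ (w i) ξ ≤ H ξ := fun i ξ => hH.inner_gradient_le (hν i) ξ
  have hwν : ∀ i, inner ℝ (ν i) (w i) = H (ν i) := fun i => by
    rw [real_inner_comm]; exact hH.inner_gradient_self (hν i)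
  have hpos : ∀ i, 0 < H (ν i) := fun i => hH.pos (hν i)
  have hai : ∀ i x (r : ℝ), a i (x + r • w i) = a i x - r := by
    intro i x r
    have := (hpos i).ne'
    simp only [ha, hyperplaneDist, inner_add_right, inner_smul_right, hwν]
    field_simp
    ring
  have haj : ∀ i j x (r : ℝ), 0 ≤ r → a j x - r ≤ a j (x + r • w i) := by
    intro i j x r hr
    have h := (abs_le.1 (hH.abs_hyperplaneDist_sub_le (hwW i) (hν j) (c j) r x)).1
    rw [abs_of_nonneg hr] at h
    simp only [ha]
    linarith
  -- Ties go to the smallest index, so that the boundary parts of the cells are disjoint.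
  set C : ℕ → Set (EuclideanSpace ℝ (Fin n)) := fun i =>
    {x | (∀ j < i, a i x < a j x) ∧ ∀ j < N, a i x ≤ a j x} with hC
  have hCm : ∀ i, MeasurableSet (C i) := by
    intro i
    have : C i = (⋂ j ∈ Set.Iio i, {x | a i x < a j x}) ∩ ⋂ j ∈ Set.Iio N, {x | a i x ≤ a j x} := by
      ext x; simp [hC]
    rw [this]
    exact (MeasurableSet.biInter (Set.to_countable _) fun j _ =>
      (isOpen_lt (hac i) (hac j)).measurableSet).inter
      (MeasurableSet.biInter (Set.to_countable _) fun j _ =>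
        (isClosed_le (hac i) (hac j)).measurableSet)
  -- Along `w i` the function `a i` decreases at rate exactly `1` and every other `a j` at rate at
  -- most `1`.
  have hCflow : ∀ i x (r : ℝ), 0 ≤ r → x ∈ C i → x + r • w i ∈ C i := by
    rintro i x r hr ⟨h1, h2⟩
    refine ⟨fun j hj => ?_, fun j hj => ?_⟩
    · rw [hai]; linarith [h1 j hj, haj i j x r hr]
    · rw [hai]; linarith [h2 j hj, haj i j x r hr]
  have hdisj : Set.PairwiseDisjoint (↑(Finset.range N)) (fun i => frontier Ω ∩ C i) := by
    have aux : ∀ i j, j < N → i < j → Disjoint (frontier Ω ∩ C i) (frontier Ω ∩ C j) :=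
      fun i j hj hij => Set.disjoint_left.2 fun x hx hx' =>
        absurd (hx'.2.1 i hij) (not_lt.2 (hx.2.2 j hj))
    intro i hi j hj hij
    rcases lt_or_gt_of_ne hij with h | h
    · exact aux i j (by simpa using hj) h
    · exact (aux j i (by simpa using hi) h).symm
  have hcell : ∀ i, volume {x ∈ Ω | x ∈ C i ∧ a i x ∈ Set.Ico s t} ≤ ENNReal.ofReal (t - s) *
      ∫⁻ x in frontier Ω ∩ C i, ENNReal.ofReal (H (outerUnitNormal Ω x)) ∂μHE[n - 1] := by
    intro i
    -- Here `ℓ = ⟨ν i, ·⟩ / H (ν i)`, so `ℓ (w i) = 1` and `a i = c i / H (ν i) - ℓ`; the sign turns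
    -- `Ico s t` into an `Ioc`.
    have h := volume_sweep_le hH hne hopen hconv hbdd hP (hwW i)
      ((H (ν i))⁻¹ • innerSL ℝ (ν i)) (by simp [hwν, (hpos i).ne'])
      (isClosed_frontier.measurableSet.inter (hCm i)) Set.inter_subset_left
      (c i / H (ν i) - t) (c i / H (ν i) - s)
    rw [sub_sub_sub_cancel_left] at h
    refine (measure_mono ?_).trans h
    rintro x ⟨hxΩ, hxC, hx1, hx2⟩
    have hwi : w i ≠ 0 := by
      intro h0
      have := hwν i
      rw [h0, inner_zero_right] at this
      exact (hpos i).ne this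
    obtain ⟨ρ, hρ, hfr⟩ := exists_add_smul_mem_frontier hbdd hxΩ hwi
    refine ⟨?_, ρ, hfr, hCflow i x ρ hρ hxC⟩
    have : a i x = c i / H (ν i) - ((H (ν i))⁻¹ • innerSL ℝ (ν i)) x := by
      simp [ha, hyperplaneDist]; ring
    rw [this] at hx1 hx2
    constructor <;> linarith
  calc _ ≤ volume (⋃ i ∈ Finset.range N, {x ∈ Ω | x ∈ C i ∧ a i x ∈ Set.Ico s t}) := by
        refine measure_mono ?_
        rintro x ⟨hxΩ, hx⟩
        classical
        obtain ⟨h1, h2, h3⟩ := Nat.find_spec hx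
        simp only [Set.mem_iUnion, Finset.mem_range]
        refine ⟨Nat.find hx, h1, hxΩ, ⟨fun j hj => ?_, h3⟩, h2⟩
        by_contra hle
        have h4 := Nat.find_min hx hj
        have h5 : a j x = a (Nat.find hx) x := le_antisymm (not_lt.1 hle) (h3 j (hj.trans h1))
        exact h4 ⟨hj.trans h1, ⟨h2.1.trans_eq h5.symm, h5.trans_lt h2.2⟩,
          fun k hk => h5.trans_le (h3 k hk)⟩
    _ ≤ ∑ i ∈ Finset.range N, volume {x ∈ Ω | x ∈ C i ∧ a i x ∈ Set.Ico s t} :=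
        measure_biUnion_finset_le _ _
    _ ≤ ∑ i ∈ Finset.range N, ENNReal.ofReal (t - s) * ∫⁻ x in frontier Ω ∩ C i,
          ENNReal.ofReal (H (outerUnitNormal Ω x)) ∂μHE[n - 1] :=
        Finset.sum_le_sum fun i _ => hcell i
    _ = ENNReal.ofReal (t - s) * ∫⁻ x in ⋃ i ∈ Finset.range N, frontier Ω ∩ C i,
          ENNReal.ofReal (H (outerUnitNormal Ω x)) ∂μHE[n - 1] := by
        rw [← Finset.mul_sum, lintegral_biUnion_finset hdisj
          fun i _ => isClosed_frontier.measurableSet.inter (hCm i)]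
    _ ≤ _ := by
        gcongr
        rw [anisotropicPerimeter]
        exact lintegral_mono_set (Set.iUnion₂_subset fun i _ => Set.inter_subset_left)

/-- The anisotropic distance to the boundary of a bounded convex open set, with the volume
of its layers controlled by the perimeter. -/
lemma exists_boundaryDist (hn : 2 ≤ n) (hH : IsAnisotropicNorm H) (hne : Ω.Nonempty)
    (hopen : IsOpen Ω) (hconv : Convex ℝ Ω) (hbdd : Bornology.IsBounded Ω)
    (hP : anisotropicPerimeter H Ω ≠ ⊤) :
    ∃ δ : EuclideanSpace ℝ (Fin n) → ℝ, (∀ x, 0 < δ x ↔ x ∈ Ω) ∧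
      (∀ w, (∀ ξ, inner ℝ w ξ ≤ H ξ) → ∀ x (r : ℝ), |δ (x + r • w) - δ x| ≤ |r|) ∧
      ∀ s t : ℝ, volume {x ∈ Ω | δ x ∈ Set.Ioo s t} ≤
        ENNReal.ofReal (t - s) * anisotropicPerimeter H Ω := by
  obtain ⟨α, β, hα, hαβ, hαβH⟩ := hH.bounds
  have hβ : 0 < β := hα.trans_le hαβ
  have : Nontrivial (EuclideanSpace ℝ (Fin n)) := by
    have : Nonempty (Fin n) := ⟨⟨0, by omega⟩⟩
    infer_instance
  have : Nonempty (Metric.sphere (0 : EuclideanSpace ℝ (Fin n)) 1) :=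
    (NormedSpace.sphere_nonempty.2 zero_le_one).to_subtype
  obtain ⟨u, hu⟩ := TopologicalSpace.exists_dense_seq
    (Metric.sphere (0 : EuclideanSpace ℝ (Fin n)) 1)
  set ν : ℕ → EuclideanSpace ℝ (Fin n) := fun i => u i with hνdef
  have hν1 : ∀ i, ‖ν i‖ = 1 := fun i => mem_sphere_zero_iff_norm.1 (u i).2
  have hν0 : ∀ i, ν i ≠ 0 := fun i h => by simpa [h] using hν1 i
  have hHν : ∀ i, α ≤ H (ν i) ∧ H (ν i) ≤ β := fun i => by
    simpa [hν1] using hαβH (ν i)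
  have hHν0 : ∀ i, 0 < H (ν i) := fun i => hH.pos (hν0 i)
  obtain ⟨R, hR⟩ := hbdd.exists_norm_le
  have hbd : ∀ i, BddAbove ((fun y => inner ℝ (ν i) y) '' Ω) := by
    intro i
    refine ⟨R, ?_⟩
    rintro _ ⟨y, hy, rfl⟩
    have := real_inner_le_norm (ν i) y
    rw [hν1, one_mul] at this
    exact this.trans (hR y hy)
  -- `c i` is the support function of `Ω` in the direction `ν i`, so `a i` measures the distance to
  -- a supporting hyperplane.
  set c : ℕ → ℝ := fun i => sSup ((fun y => inner ℝ (ν i) y) '' Ω) with hc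
  have hcle : ∀ i, ∀ y ∈ Ω, inner ℝ (ν i) y ≤ c i := fun i y hy =>
    le_csSup (hbd i) ⟨y, hy, rfl⟩
  set a : ℕ → EuclideanSpace ℝ (Fin n) → ℝ := fun i => hyperplaneDist H (ν i) (c i) with ha
  have hbelow : ∀ x, BddBelow (Set.range fun i => a i x) := by
    intro x
    obtain ⟨y, hy⟩ := hne
    refine ⟨-(‖y - x‖ / α), ?_⟩
    rintro _ ⟨i, rfl⟩
    have h1 := hcle i y hy
    have h2 := neg_le_of_abs_le (abs_real_inner_le_norm (ν i) (y - x))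
    rw [hν1, one_mul, inner_sub_right] at h2
    simp only [ha, hyperplaneDist]
    rw [le_div_iff₀ (hHν0 i)]
    have h3 : ‖y - x‖ / α * α = ‖y - x‖ := by field_simp
    nlinarith [(hHν i).1, div_nonneg (norm_nonneg (y - x)) hα.le]
  set δ : EuclideanSpace ℝ (Fin n) → ℝ := fun x => ⨅ i, a i x with hδ
  have hδle : ∀ x i, δ x ≤ a i x := fun x i => ciInf_le (hbelow x) i
  refine ⟨δ, fun x => ⟨fun hx => ?_, fun hx => ?_⟩, fun w hw x r => ?_, fun s t => ?_⟩
  · by_contra hxΩ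
    obtain ⟨v, hv1, hv⟩ := exists_isOuterUnitNormal hopen hconv hne hxΩ
    set M := R + ‖x‖ + 1
    have hM : 0 < M := by
      obtain ⟨y, hy⟩ := hne
      linarith [norm_nonneg y, hR y hy, norm_nonneg x]
    -- `M` bounds `‖y - x‖` for `y ∈ Ω`. A direction this close to the separating normal `v` gives
    -- `a i x ≤ δ x / 2`, which contradicts `δ x ≤ a i x`.
    have hη : 0 < δ x * α / (2 * M) := by positivity
    obtain ⟨i, hi⟩ := hu.exists_dist_lt ⟨v, by simpa using hv1⟩ hη
    have hi' : ‖v - ν i‖ < δ x * α / (2 * M) := by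
      simpa [Subtype.dist_eq, dist_eq_norm] using hi
    have h1 : c i ≤ inner ℝ (ν i) x + δ x * α / 2 := by
      refine csSup_le (hne.image _) ?_
      rintro _ ⟨y, hy, rfl⟩
      have h2 := hv y hy
      have h3 := neg_le_of_abs_le (abs_real_inner_le_norm (v - ν i) (y - x))
      have h4 : ‖y - x‖ ≤ M := by
        have := norm_sub_le y x
        have := hR y hy
        simp only [M]
        linarith
      have h5 : ‖v - ν i‖ * ‖y - x‖ ≤ δ x * α / (2 * M) * M := by gcongr
      have h6 : δ x * α / (2 * M) * M = δ x * α / 2 := by field_simp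
      have h7 : inner ℝ (v - ν i) (y - x) =
          inner ℝ v (y - x) - (inner ℝ (ν i) y - inner ℝ (ν i) x) := by
        rw [inner_sub_left, inner_sub_right (ν i)]
      simp only
      linarith
    have h2 := hδle x i
    simp only [ha, hyperplaneDist] at h2
    rw [le_div_iff₀ (hHν0 i)] at h2
    have h3 : δ x * α ≤ δ x * H (ν i) := by gcongr; exact (hHν i).1
    nlinarith [mul_pos hx hα]
  · obtain ⟨r, hr, hball⟩ := Metric.isOpen_iff.1 hopen x hx
    refine (by positivity : 0 < r / 2 / β).trans_le (le_ciInf fun i => ?_)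
    have h1 : x + (r / 2) • ν i ∈ Ω := hball (by
      rw [Metric.mem_ball, dist_eq_norm, add_sub_cancel_left, norm_smul, hν1,
        Real.norm_of_nonneg (by positivity)]
      linarith)
    have h2 := hcle i _ h1
    rw [inner_add_right, inner_smul_right, real_inner_self_eq_norm_sq, hν1] at h2
    simp only [ha, hyperplaneDist]
    gcongr
    · linarith [hHν0 i, (by linarith : r / 2 ≤ c i - inner ℝ (ν i) x)]
    · exact hHν0 i
    · linarith
    · exact (hHν i).2
  · have main : ∀ (x : EuclideanSpace ℝ (Fin n)) (r : ℝ), δ x - |r| ≤ δ (x + r • w) := by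
      intro x r
      refine le_ciInf fun i => ?_
      have := (abs_le.1 (hH.abs_hyperplaneDist_sub_le hw (hν0 i) (c i) r x)).1
      have := hδle x i
      simp only [ha] at this ⊢
      linarith
    have h1 := main x r
    have h2 := main (x + r • w) (-r)
    rw [abs_neg, add_assoc, ← add_smul, add_neg_cancel, zero_smul, add_zero] at h2
    exact abs_le.2 ⟨by linarith, by linarith⟩
  · set G : ℕ → Set (EuclideanSpace ℝ (Fin n)) := fun N => {x ∈ Ω | ∃ i < N,
      a i x ∈ Set.Ico s t ∧ ∀ j < N, a i x ≤ a j x} with hG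
    have hGle : ∀ N, volume (G N) ≤ ENNReal.ofReal (t - s) * anisotropicPerimeter H Ω :=
      fun N => volume_layer_min_le hH hne hopen hconv hbdd hP hν0 c N s t
    -- Each point of the layer of `δ` lies in `G M` for all large `M`; the sets `⋂ M ≥ N, G M`
    -- increase with `N`, so the bound on each `G N` passes to the union.
    have hmono : Monotone fun N => ⋂ M ∈ Set.Ici N, G M := fun N N' h =>
      Set.biInter_subset_biInter_left fun M hM => le_trans h hM
    have hsub : {x ∈ Ω | δ x ∈ Set.Ioo s t} ⊆ ⋃ N, ⋂ M ∈ Set.Ici N, G M := by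
      rintro x ⟨hxΩ, hx1, hx2⟩
      obtain ⟨i, hi⟩ := exists_lt_of_ciInf_lt hx2
      simp only [Set.mem_iUnion, Set.mem_iInter]
      refine ⟨i + 1, fun M hM => ⟨hxΩ, ?_⟩⟩
      have hiM : i < M := hM
      obtain ⟨k, hk, hkmin⟩ := Finset.exists_min_image (Finset.range M) (fun j => a j x)
        ⟨i, Finset.mem_range.2 hiM⟩
      refine ⟨k, Finset.mem_range.1 hk, ⟨(hx1.trans_le (hδle x k)).le,
        (hkmin i (Finset.mem_range.2 hiM)).trans_lt hi⟩,
        fun j hj => hkmin j (Finset.mem_range.2 hj)⟩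
    refine (measure_mono hsub).trans ?_
    rw [hmono.measure_iUnion]
    exact iSup_le fun N =>
      (measure_mono (Set.biInter_subset_of_mem Set.self_mem_Ici)).trans (hGle N)

end Layers

/-! ### Distribution function of `δ` and its moments. -/

section Tail

variable {X : Type*} [MeasurableSpace X] {μ : Measure X} {δ : X → ℝ} {P R : ℝ}

/-- The measure of the superlevel set `{t < δ}`. -/
noncomputable def tailMeasure (μ : Measure X) (δ : X → ℝ) (t : ℝ) : ℝ :=
  μ.real {x | t < δ x}

lemma tailMeasure_nonneg (t : ℝ) : 0 ≤ tailMeasure μ δ t := measureReal_nonneg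

lemma tailMeasure_antitone [IsFiniteMeasure μ] : Antitone (tailMeasure μ δ) := fun _ _ h =>
  measureReal_mono fun _ hx => lt_of_le_of_lt h hx

lemma ofReal_tailMeasure [IsFiniteMeasure μ] (t : ℝ) :
    ENNReal.ofReal (tailMeasure μ δ t) = μ {x | t < δ x} := by
  simp [tailMeasure]

lemma tailMeasure_of_nonpos (hpos : ∀ᵐ x ∂μ, 0 < δ x) {t : ℝ} (ht : t ≤ 0) :
    tailMeasure μ δ t = μ.real Set.univ := by
  refine measureReal_congr ?_
  filter_upwards [hpos] with x hx
  exact propext ⟨fun _ => trivial, fun _ => ht.trans_lt hx⟩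

lemma tailMeasure_le [IsFiniteMeasure μ] (t : ℝ) : tailMeasure μ δ t ≤ μ.real Set.univ :=
  measureReal_mono (Set.subset_univ _)

lemma tailMeasure_of_ge (hR : ∀ᵐ x ∂μ, δ x ≤ R) : tailMeasure μ δ R = 0 := by
  have : μ {x | R < δ x} = 0 := by
    refine measure_mono_null (fun x hx => ?_) (ae_iff.1 hR)
    exact not_le.2 hx
  simp [tailMeasure, measureReal_def, this]

lemma tailMeasure_sub_le [IsFiniteMeasure μ]
    (hlayer : ∀ s t, s ≤ t → μ.real {x | δ x ∈ Set.Ioo s t} ≤ P * (t - s))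
    {s t : ℝ} (hst : s ≤ t) : tailMeasure μ δ s - tailMeasure μ δ t ≤ P * (t - s) := by
  have h1 : ∀ η : ℝ, 0 < η → tailMeasure μ δ s - tailMeasure μ δ t ≤ P * (t + η - s) := by
    intro η hη
    -- The margin `η` takes in the level set `δ = t`, which the open layer from `s` to `t` misses.
    have h2 : tailMeasure μ δ s ≤ μ.real {x | δ x ∈ Set.Ioo s (t + η)} + tailMeasure μ δ t := by
      refine (measureReal_mono ?_).trans (measureReal_union_le _ _)
      intro x (hx : s < δ x)
      rcases lt_or_ge (δ x) (t + η) with h | h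
      · exact Or.inl ⟨hx, h⟩
      · exact Or.inr (show t < δ x by linarith)
    linarith [hlayer s (t + η) (by linarith)]
  have h2 : Tendsto (fun η : ℝ => P * (t + η - s)) (𝓝[>] 0) (𝓝 (P * (t + 0 - s))) :=
    (Continuous.tendsto (by fun_prop) 0).mono_left nhdsWithin_le_nhds
  rw [add_zero] at h2
  refine ge_of_tendsto h2 ?_
  filter_upwards [self_mem_nhdsWithin] with η hη using h1 η hη

lemma continuous_tailMeasure [IsFiniteMeasure μ] (hP : 0 ≤ P)
    (hlayer : ∀ s t, s ≤ t → μ.real {x | δ x ∈ Set.Ioo s t} ≤ P * (t - s)) :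
    Continuous (tailMeasure μ δ) := by
  refine (LipschitzWith.of_dist_le_mul (K := P.toNNReal) fun s t => ?_).continuous
  rw [Real.coe_toNNReal _ hP]
  wlog h : s ≤ t generalizing s t
  · rw [dist_comm, dist_comm s]
    exact this t s (le_of_not_ge h)
  rw [Real.dist_eq, Real.dist_eq, abs_of_nonneg (sub_nonneg.2 (tailMeasure_antitone h)),
    abs_sub_comm, abs_of_nonneg (sub_nonneg.2 h)]
  exact tailMeasure_sub_le hlayer h

/-- The power moment of the uniform distribution, in layer cake form. -/
lemma lintegral_layer_uniform {q v : ℝ} (hq : 0 < q) (hv : 0 ≤ v) :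
    ENNReal.ofReal q * ∫⁻ t in Set.Ioi 0, ENNReal.ofReal (v - t) * ENNReal.ofReal (t ^ (q - 1)) =
      ENNReal.ofReal (v ^ (q + 1) / (q + 1)) := by
  have h := lintegral_rpow_eq_lintegral_meas_lt_mul (volume.restrict (Set.Ioo 0 v))
    (f := fun x => x) ((ae_restrict_mem measurableSet_Ioo).mono fun x hx => hx.1.le)
    aemeasurable_id hq
  have h1 : ∀ t ∈ Set.Ioi (0 : ℝ), (volume.restrict (Set.Ioo 0 v)) {a : ℝ | t < a} *
      ENNReal.ofReal (t ^ (q - 1)) = ENNReal.ofReal (v - t) * ENNReal.ofReal (t ^ (q - 1)) := by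
    intro t ht
    have : {a : ℝ | t < a} ∩ Set.Ioo 0 v = Set.Ioo t v := by
      ext a
      simp only [Set.mem_inter_iff, Set.mem_ofPred_eq, Set.mem_Ioo]
      exact ⟨fun h => ⟨h.1, h.2.2⟩, fun h => ⟨h.1, lt_trans ht h.1, h.2⟩⟩
    rw [Measure.restrict_apply' measurableSet_Ioo, this, Real.volume_Ioo]
  rw [setLIntegral_congr_fun measurableSet_Ioi h1] at h
  rw [← h, ← ofReal_integral_eq_lintegral_ofReal]
  · rw [← integral_Ioc_eq_integral_Ioo, ← intervalIntegral.integral_of_le hv,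
      integral_rpow (Or.inl (by linarith)), Real.zero_rpow (by linarith), sub_zero]
  · have := (intervalIntegral.intervalIntegrable_rpow' (a := 0) (b := v)
      (r := q) (by linarith))
    exact ((intervalIntegrable_iff_integrableOn_Ioc_of_le hv).1 this).mono_set
      Set.Ioo_subset_Ioc_self
  · exact (ae_restrict_mem measurableSet_Ioo).mono fun x hx => Real.rpow_nonneg hx.1.le _

/-- `V(δ)` is distributed uniformly, when `V` is the tail of `δ`. -/
lemma lintegral_tailMeasure_comp_le [IsFiniteMeasure μ] (hδ : Measurable δ) (hP : 0 ≤ P)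
    (hlayer : ∀ s t, s ≤ t → μ.real {x | δ x ∈ Set.Ioo s t} ≤ P * (t - s))
    (hpos : ∀ᵐ x ∂μ, 0 < δ x) (hR : ∀ᵐ x ∂μ, δ x ≤ R) (hR0 : 0 ≤ R) {q : ℝ} (hq : 0 < q) :
    ∫⁻ x, ENNReal.ofReal (tailMeasure μ δ (δ x) ^ q) ∂μ ≤
      ENNReal.ofReal (μ.real Set.univ ^ (q + 1) / (q + 1)) := by
  have hc := continuous_tailMeasure hP hlayer
  rw [← lintegral_layer_uniform hq measureReal_nonneg,
    lintegral_rpow_eq_lintegral_meas_lt_mul μ (Eventually.of_forall fun x => tailMeasure_nonneg _)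
      (hc.measurable.comp hδ).aemeasurable hq]
  gcongr ENNReal.ofReal q * ?_
  refine setLIntegral_mono' measurableSet_Ioi fun r (hr : 0 < r) => ?_
  gcongr
  rcases le_or_gt (μ.real Set.univ) r with h | h
  · have : {x | r < tailMeasure μ δ (δ x)} = ∅ :=
      Set.eq_empty_of_forall_notMem fun x hx => not_lt.2 ((tailMeasure_le _).trans h) hx
    simp [this]
  -- By continuity `r = V(t)` for some `t`. Then `V(δ) > r` forces `δ ≤ t`, a set of measure `|Ω| -
  -- r`.
  · obtain ⟨t, -, ht⟩ : r ∈ tailMeasure μ δ '' Set.Icc 0 R :=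
      intermediate_value_Icc' hR0 hc.continuousOn
        ⟨by rw [tailMeasure_of_ge hR]; exact hr.le,
          by rw [tailMeasure_of_nonpos hpos le_rfl]; exact h.le⟩
    have hsub : {x | r < tailMeasure μ δ (δ x)} ⊆ {x | t < δ x}ᶜ := by
      intro x hx hx'
      have : tailMeasure μ δ (δ x) ≤ r := by rw [← ht]; exact tailMeasure_antitone (le_of_lt hx')
      exact not_lt.2 this hx
    refine (measure_mono hsub).trans ?_
    rw [← ht, tailMeasure, ← measureReal_compl (measurableSet_lt measurable_const hδ),
      ofReal_measureReal]

/-- If the layers of `δ` have measure at most `P` times their width, then the moments of its tail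
are bounded below. -/
lemma le_lintegral_tailMeasure [IsFiniteMeasure μ] (hP : 0 < P)
    (hlayer : ∀ s t, s ≤ t → μ.real {x | δ x ∈ Set.Ioo s t} ≤ P * (t - s))
    (hpos : ∀ᵐ x ∂μ, 0 < δ x) {q : ℝ} (hq : 0 < q) :
    ENNReal.ofReal (μ.real Set.univ ^ (q + 1) / (q + 1)) ≤ ENNReal.ofReal P *
      ∫⁻ t in Set.Ioi 0, ENNReal.ofReal (tailMeasure μ δ t ^ q) := by
  have hc := continuous_tailMeasure hP.le hlayer
  rw [← lintegral_layer_uniform hq measureReal_nonneg,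
    lintegral_rpow_eq_lintegral_meas_lt_mul _ (Eventually.of_forall fun x => tailMeasure_nonneg _)
      hc.measurable.aemeasurable hq, mul_left_comm]
  gcongr
  rw [← lintegral_const_mul' _ _ ENNReal.ofReal_ne_top]
  refine setLIntegral_mono' measurableSet_Ioi fun r (hr : 0 < r) => ?_
  rw [← mul_assoc]
  gcongr
  -- Starting from the total mass and falling at rate at most `P`, the tail stays above `r` until
  -- time `(|Ω| - r) / P`.
  have hsub : Set.Ioo 0 ((μ.real Set.univ - r) / P) ⊆ {t | r < tailMeasure μ δ t} ∩ Set.Ioi 0 := by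
    rintro t ⟨ht0, ht⟩
    refine ⟨?_, ht0⟩
    rw [lt_div_iff₀ hP] at ht
    have h := tailMeasure_sub_le hlayer ht0.le
    rw [tailMeasure_of_nonpos hpos le_rfl] at h
    show r < tailMeasure μ δ t
    nlinarith
  have h : ENNReal.ofReal ((μ.real Set.univ - r) / P) ≤
      volume ({t | r < tailMeasure μ δ t} ∩ Set.Ioi 0) := by
    simpa using measure_mono (μ := volume) hsub
  calc ENNReal.ofReal (μ.real Set.univ - r)
      = ENNReal.ofReal P * ENNReal.ofReal ((μ.real Set.univ - r) / P) := by
        rw [← ENNReal.ofReal_mul hP.le]; congr 1; field_simp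
    _ ≤ _ := by
        rw [Measure.restrict_apply' measurableSet_Ioi]
        gcongr

/-- The primitive of `V ^ θ`, where `V` is the tail of `δ`. -/
noncomputable def tailPrimitive (μ : Measure X) (δ : X → ℝ) (θ t : ℝ) : ℝ :=
  ∫ s in (0 : ℝ)..t, tailMeasure μ δ s ^ θ

/-- Layer cake: `∫ f(δ) = ∫ V f'` with `f' = V ^ θ`. -/
lemma lintegral_tailPrimitive [IsFiniteMeasure μ] (hδ : Measurable δ) (hP : 0 ≤ P)
    (hlayer : ∀ s t, s ≤ t → μ.real {x | δ x ∈ Set.Ioo s t} ≤ P * (t - s))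
    (hpos : ∀ᵐ x ∂μ, 0 < δ x) {θ : ℝ} (hθ : 0 < θ) :
    ∫⁻ x, ENNReal.ofReal (tailPrimitive μ δ θ (δ x)) ∂μ =
      ∫⁻ t in Set.Ioi 0, ENNReal.ofReal (tailMeasure μ δ t ^ (1 + θ)) := by
  have hc := (continuous_tailMeasure hP hlayer).rpow_const (p := θ) fun _ => Or.inr hθ.le
  unfold tailPrimitive
  rw [lintegral_comp_eq_lintegral_meas_lt_mul μ (hpos.mono fun x hx => hx.le) hδ.aemeasurable
    (fun t _ => hc.intervalIntegrable 0 t)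
    (Eventually.of_forall fun t => Real.rpow_nonneg (tailMeasure_nonneg t) θ)]
  refine lintegral_congr fun t => ?_
  rw [← ofReal_tailMeasure, ← ENNReal.ofReal_mul (tailMeasure_nonneg t),
    Real.rpow_one_add' (tailMeasure_nonneg t) (by positivity)]

lemma hasDerivAt_tailPrimitive [IsFiniteMeasure μ] (hP : 0 ≤ P)
    (hlayer : ∀ s t, s ≤ t → μ.real {x | δ x ∈ Set.Ioo s t} ≤ P * (t - s)) {θ : ℝ} (hθ : 0 < θ)
    (t : ℝ) : HasDerivAt (tailPrimitive μ δ θ) (tailMeasure μ δ t ^ θ) t := by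
  have hc := (continuous_tailMeasure hP hlayer).rpow_const (p := θ) fun _ => Or.inr hθ.le
  exact hc.integral_hasStrictDerivAt 0 t |>.hasDerivAt

lemma tailPrimitive_monotone [IsFiniteMeasure μ] (hP : 0 ≤ P)
    (hlayer : ∀ s t, s ≤ t → μ.real {x | δ x ∈ Set.Ioo s t} ≤ P * (t - s)) {θ : ℝ} (hθ : 0 < θ) :
    Monotone (tailPrimitive μ δ θ) :=
  monotone_of_hasDerivAt_nonneg (hasDerivAt_tailPrimitive hP hlayer hθ)
    fun t => Real.rpow_nonneg (tailMeasure_nonneg t) θ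

lemma tailPrimitive_zero (θ : ℝ) : tailPrimitive μ δ θ 0 = 0 := by simp [tailPrimitive]

/-- On `[a, ∞)` the primitive is Lipschitz with constant `V(a) ^ θ`. -/
lemma tailPrimitive_sub_le [IsFiniteMeasure μ] (hP : 0 ≤ P)
    (hlayer : ∀ s t, s ≤ t → μ.real {x | δ x ∈ Set.Ioo s t} ≤ P * (t - s)) {θ : ℝ} (hθ : 0 < θ)
    {a s t : ℝ} (hs : a ≤ s) (ht : a ≤ t) :
    |tailPrimitive μ δ θ t - tailPrimitive μ δ θ s| ≤ tailMeasure μ δ a ^ θ * |t - s| := by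
  have h := (convex_Ici a).norm_image_sub_le_of_norm_hasDerivWithin_le
    (f := tailPrimitive μ δ θ) (f' := fun r => tailMeasure μ δ r ^ θ)
    (C := tailMeasure μ δ a ^ θ)
    (fun r _ => (hasDerivAt_tailPrimitive hP hlayer hθ r).hasDerivWithinAt)
    (fun r (hr : a ≤ r) => by
      rw [Real.norm_of_nonneg (Real.rpow_nonneg (tailMeasure_nonneg r) θ)]
      exact Real.rpow_le_rpow (tailMeasure_nonneg r) (tailMeasure_antitone hr) hθ.le)
    hs ht
  simpa [Real.norm_eq_abs] using h

end Tail

/-! ### Smooth test functions built from `δ`. -/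

section TestFunction

variable {n : ℕ} {H : EuclideanSpace ℝ (Fin n) → ℝ} {Ω : Set (EuclideanSpace ℝ (Fin n))}
  {δ : EuclideanSpace ℝ (Fin n) → ℝ}

/-- A function which is `1`-Lipschitz along the dual unit ball is Lipschitz. -/
lemma IsAnisotropicNorm.exists_abs_sub_le (hH : IsAnisotropicNorm H)
    (hδ : ∀ w, (∀ ξ, inner ℝ w ξ ≤ H ξ) → ∀ x (r : ℝ), |δ (x + r • w) - δ x| ≤ |r|) :
    ∃ C : ℝ, 0 < C ∧ ∀ x v, |δ (x + v) - δ x| ≤ C * ‖v‖ := by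
  obtain ⟨α, β, hα, -, hα'⟩ := hH.bounds
  refine ⟨α⁻¹, by positivity, fun x v => ?_⟩
  rcases eq_or_ne v 0 with rfl | hv
  · simp
  have hv' : 0 < ‖v‖ := norm_pos_iff.2 hv
  -- This multiple of `v` has Euclidean norm `α`, hence dual norm at most `1`.
  have h := hδ ((α / ‖v‖) • v) (fun ξ => ?_) x (α⁻¹ * ‖v‖)
  · rw [smul_smul, show α⁻¹ * ‖v‖ * (α / ‖v‖) = 1 by field_simp, one_smul] at h
    rwa [abs_of_nonneg (by positivity : 0 ≤ α⁻¹ * ‖v‖)] at h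
  · refine le_trans ?_ (hα' ξ).1
    rw [real_inner_smul_left, div_mul_eq_mul_div, mul_div_assoc]
    gcongr
    rw [div_le_iff₀ hv', mul_comm]
    exact real_inner_le_norm v ξ

lemma IsAnisotropicNorm.continuous_of_abs_sub_le (hH : IsAnisotropicNorm H)
    (hδ : ∀ w, (∀ ξ, inner ℝ w ξ ≤ H ξ) → ∀ x (r : ℝ), |δ (x + r • w) - δ x| ≤ |r|) :
    Continuous δ := by
  obtain ⟨C, hC, hδC⟩ := hH.exists_abs_sub_le hδ
  refine (LipschitzWith.of_dist_le_mul (K := C.toNNReal) fun x y => ?_).continuous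
  have h := hδC y (x - y)
  rw [add_sub_cancel] at h
  rwa [Real.dist_eq, dist_eq_norm, Real.coe_toNNReal _ hC.le]

/-- Smooth approximation from below of `f ∘ δ` by compactly supported functions, keeping
control of the anisotropic norm of the gradient. -/
lemma exists_smooth_comp_boundaryDist (hH : IsAnisotropicNorm H) (hbdd : Bornology.IsBounded Ω)
    (hpos : ∀ x, 0 < δ x ↔ x ∈ Ω)
    (hδ : ∀ w, (∀ ξ, inner ℝ w ξ ≤ H ξ) → ∀ x (r : ℝ), |δ (x + r • w) - δ x| ≤ |r|)
    {f L : ℝ → ℝ} (hf : Continuous f) (hmono : Monotone f) (hf0 : f 0 = 0) (hL0 : ∀ a, 0 ≤ L a)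
    (hL : ∀ a s t, a ≤ s → a ≤ t → |f t - f s| ≤ L a * |t - s|) {ε : ℝ} (hε : 0 < ε) :
    ∃ φ : EuclideanSpace ℝ (Fin n) → ℝ, ContDiff ℝ ∞ φ ∧ HasCompactSupport φ ∧ tsupport φ ⊆ Ω ∧
      (∀ x, f (max (δ x - ε) 0) ≤ φ x) ∧ ∀ x, H (gradient φ x) ≤ L (δ x - ε) := by
  obtain ⟨C, hC, hδC⟩ := hH.exists_abs_sub_le hδ
  have hδc : Continuous δ := hH.continuous_of_abs_sub_le hδ
  -- The budget `ε`: a cut at `ε/2` leaves room for mollification, which moves `δ` by at most `ε/4`,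
  -- and for a further shift `τ < ε/4` in the difference quotient.
  set F : EuclideanSpace ℝ (Fin n) → ℝ := fun x => f (max (δ x - ε / 2) 0) with hF
  have hFc : Continuous F := by fun_prop
  have hr : 0 < ε / (4 * C) := by positivity
  let b : ContDiffBump (0 : EuclideanSpace ℝ (Fin n)) :=
    ⟨ε / (4 * C) / 2, ε / (4 * C), by positivity, by linarith⟩
  set ψ : EuclideanSpace ℝ (Fin n) → ℝ := b.normed volume with hψ
  have hψ0 : ∀ y, 0 ≤ ψ y := fun y => b.nonneg_normed y
  have hψc : HasCompactSupport ψ := b.hasCompactSupport_normed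
  have hψcont : Continuous ψ := b.continuous_normed
  have hψ1 : ∫ y, ψ y = 1 := b.integral_normed
  have hsupp : ∀ y, ψ y ≠ 0 → ‖y‖ < ε / (4 * C) := by
    intro y hy
    have h : y ∈ Function.support (b.normed volume) := hy
    rw [b.support_normed_eq] at h
    simpa using h
  have hnear : ∀ x y, ψ y ≠ 0 → |δ (x - y) - δ x| ≤ ε / 4 := by
    intro x y hy
    have h := hδC x (-y)
    rw [norm_neg, ← sub_eq_add_neg] at h
    refine h.trans ?_
    calc C * ‖y‖ ≤ C * (ε / (4 * C)) := by gcongr; exact (hsupp y hy).le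
      _ = ε / 4 := by field_simp
  set φ : EuclideanSpace ℝ (Fin n) → ℝ := convolution ψ F (ContinuousLinearMap.lsmul ℝ ℝ) volume
    with hφ
  have hφx : ∀ x, φ x = ∫ y, ψ y * F (x - y) := fun x => by
    simp [hφ, convolution]
  have hint : ∀ x, Integrable fun y => ψ y * F (x - y) := fun x =>
    (hψcont.mul (by fun_prop)).integrable_of_hasCompactSupport hψc.mul_right
  have hψint : Integrable ψ := hψcont.integrable_of_hasCompactSupport hψc
  have hcd : ContDiff ℝ ∞ φ :=
    hψc.contDiff_convolution_left _ b.contDiff_normed hFc.locallyIntegrable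
  have hsup : Function.support φ ⊆ {x | ε / 4 ≤ δ x} := by
    intro x hx
    by_contra hlt
    refine hx ?_
    rw [hφx]
    refine integral_eq_zero_of_ae (Eventually.of_forall fun y => ?_)
    by_cases hy : ψ y = 0
    · simp [hy]
    · have h := (abs_le.1 (hnear x y hy)).2
      have : δ (x - y) - ε / 2 ≤ 0 := by
        have : δ x < ε / 4 := not_le.1 hlt
        linarith
      simp [hF, max_eq_right this, hf0]
  have hts : tsupport φ ⊆ {x | ε / 4 ≤ δ x} :=
    closure_minimal hsup (isClosed_le continuous_const hδc)
  have htsΩ : tsupport φ ⊆ Ω := hts.trans fun x (hx : ε / 4 ≤ δ x) =>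
    (hpos x).1 (by linarith)
  refine ⟨φ, hcd, Metric.isCompact_of_isClosed_isBounded (isClosed_tsupport φ)
    (hbdd.subset htsΩ), htsΩ, fun x => ?_, fun x => ?_⟩
  · rw [hφx, ← one_mul (f _), ← hψ1, ← integral_mul_const]
    refine integral_mono (hψint.mul_const _) (hint x) fun y => ?_
    by_cases hy : ψ y = 0
    · simp [hy]
    · have h := (abs_le.1 (hnear x y hy)).1
      refine mul_le_mul_of_nonneg_left (hmono (max_le_max ?_ le_rfl)) (hψ0 y)
      linarith
  · rcases eq_or_ne (gradient φ x) 0 with h0 | h0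
    · rw [h0, hH.map_zero]; exact hL0 _
    -- By Euler's identity the derivative of `φ` along `w` is `H (gradient φ x)`; since `w` lies in
    -- the dual unit ball, `δ` is `1`-Lipschitz along it.
    set w := gradient H (gradient φ x) with hw
    have hwW : ∀ ξ, inner ℝ w ξ ≤ H ξ := hH.inner_gradient_le h0
    rw [← hH.inner_gradient_self h0, real_inner_comm]
    have hder : HasDerivAt (fun τ : ℝ => φ (x + τ • w)) (inner ℝ (gradient φ x) w) 0 := by
      have h := ((hcd.differentiable (by simp)) x).hasGradientAt.hasFDerivAt
      have h1 : HasDerivAt (fun t : ℝ => x + t • w) w 0 := by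
        simpa using ((hasDerivAt_id (0 : ℝ)).smul_const w).const_add x
      have h2 : HasFDerivAt φ (InnerProductSpace.toDual ℝ _ (gradient φ x)) (x + (0 : ℝ) • w) := by
        simpa using h
      simpa [Function.comp_def] using h2.comp_hasDerivAt 0 h1
    refine le_of_tendsto hder.tendsto_slope_zero_right ?_
    filter_upwards [Ioo_mem_nhdsGT (show (0 : ℝ) < ε / 4 by positivity)] with τ hτ
    simp only [zero_add, zero_smul, add_zero, smul_eq_mul]
    rw [inv_mul_le_iff₀ hτ.1, hφx, hφx, ← integral_sub (hint _) (hint _), mul_comm τ,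
      ← one_mul (L _ * τ), ← hψ1, ← integral_mul_const]
    refine integral_mono ((hint _).sub (hint _)) (hψint.mul_const _) fun y => ?_
    by_cases hy : ψ y = 0
    · simp [hy]
    simp only [← mul_sub]
    refine mul_le_mul_of_nonneg_left ?_ (hψ0 y)
    have h1 := (abs_le.1 (hnear x y hy)).1
    have h2 := hδ w hwW (x - y) τ
    rw [show x - y + τ • w = x + τ • w - y by abel, abs_of_pos hτ.1] at h2
    have h3 := (abs_le.1 h2).1
    have h4 : |max (δ (x + τ • w - y) - ε / 2) 0 - max (δ (x - y) - ε / 2) 0| ≤ τ :=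
      (abs_max_sub_max_le_abs _ _ _).trans (by rwa [sub_sub_sub_cancel_right])
    calc F (x + τ • w - y) - F (x - y) ≤ |F (x + τ • w - y) - F (x - y)| := le_abs_self _
      _ ≤ L (δ x - ε) * |max (δ (x + τ • w - y) - ε / 2) 0 - max (δ (x - y) - ε / 2) 0| :=
          hL _ _ _ (le_max_of_le_left (by linarith)) (le_max_of_le_left (by linarith [hτ.2]))
      _ ≤ L (δ x - ε) * τ := by gcongr; exact hL0 _

end TestFunction

/-! ### Poincaré inequality and upper bounds of the quotients. -/

section Sobolev

variable {n : ℕ} {H : EuclideanSpace ℝ (Fin n) → ℝ} {Ω : Set (EuclideanSpace ℝ (Fin n))} {p : ℝ}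

lemma norm_gradient_eq (φ : EuclideanSpace ℝ (Fin n) → ℝ) (x : EuclideanSpace ℝ (Fin n)) :
    ‖gradient φ x‖ = ‖fderiv ℝ φ x‖ := by
  simp [gradient]

lemma continuous_gradient {φ : EuclideanSpace ℝ (Fin n) → ℝ} (hφ : ContDiff ℝ ∞ φ) :
    Continuous (gradient φ) :=
  (InnerProductSpace.toDual ℝ (EuclideanSpace ℝ (Fin n))).symm.continuous.comp
    (hφ.continuous_fderiv (by simp))

lemma support_gradient_subset (φ : EuclideanSpace ℝ (Fin n) → ℝ) :
    Function.support (gradient φ) ⊆ tsupport φ := by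
  refine fun x hx => support_fderiv_subset ℝ fun h => hx ?_
  rw [← norm_eq_zero, norm_gradient_eq, h, norm_zero]

lemma hasCompactSupport_gradient {φ : EuclideanSpace ℝ (Fin n) → ℝ} (hφ : HasCompactSupport φ) :
    HasCompactSupport (gradient φ) :=
  hφ.mono' (support_gradient_subset φ)

lemma memSobolevZero_of_smooth {φ : EuclideanSpace ℝ (Fin n) → ℝ} (hφ : ContDiff ℝ ∞ φ)
    (hc : HasCompactSupport φ) (hs : tsupport φ ⊆ Ω) : MemSobolevZero p Ω φ (gradient φ) :=
  ⟨(hφ.continuous.memLp_of_hasCompactSupport hc).restrict _,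
    ((continuous_gradient hφ).memLp_of_hasCompactSupport
      (hasCompactSupport_gradient hc)).restrict _,
    fun _ => φ, fun _ => ⟨hφ, hc, hs⟩, by simp, by simp⟩

lemma IsAnisotropicNorm.memLp_comp (hH : IsAnisotropicNorm H) {q : ℝ≥0∞}
    {μ : Measure (EuclideanSpace ℝ (Fin n))}
    {g : EuclideanSpace ℝ (Fin n) → EuclideanSpace ℝ (Fin n)} (hg : MemLp g q μ) :
    MemLp (fun x => H (g x)) q μ := by
  obtain ⟨α, β, -, -, h⟩ := hH.bounds
  refine hg.of_le_mul (c := β) (hH.continuous.comp_aestronglyMeasurable hg.1)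
    (Eventually.of_forall fun x => ?_)
  rw [Real.norm_of_nonneg (hH.nonneg _)]
  exact (h _).2

lemma IsAnisotropicNorm.integrable_rpow (hH : IsAnisotropicNorm H) (hp : 1 < p)
    {μ : Measure (EuclideanSpace ℝ (Fin n))}
    {g : EuclideanSpace ℝ (Fin n) → EuclideanSpace ℝ (Fin n)} (hg : MemLp g (ENNReal.ofReal p) μ) :
    Integrable (fun x => H (g x) ^ p) μ := by
  have h := (hH.memLp_comp hg).integrable_norm_rpow (by simpa using by linarith) (by simp)
  rw [ENNReal.toReal_ofReal (by linarith)] at h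
  refine h.congr (Eventually.of_forall fun x => ?_)
  simp only [Real.norm_of_nonneg (hH.nonneg _)]

/-- Poincaré's inequality for smooth functions, with `L¹` norm on the left. -/
lemma exists_eLpNorm_one_le_smooth (hn : 2 ≤ n) (hp : 1 < p) (hbdd : Bornology.IsBounded Ω) :
    ∃ C : ℝ≥0∞, C ≠ ⊤ ∧ ∀ φ : EuclideanSpace ℝ (Fin n) → ℝ, ContDiff ℝ ∞ φ →
      HasCompactSupport φ → tsupport φ ⊆ Ω →
      eLpNorm φ 1 (volume.restrict Ω) ≤
        C * eLpNorm (gradient φ) (ENNReal.ofReal p) (volume.restrict Ω) := by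
  have hfin : volume Ω ≠ ⊤ := hbdd.measure_lt_top.ne
  have hp1 : (1 : ℝ≥0∞) ≤ ENNReal.ofReal p := by
    rw [← ENNReal.ofReal_one]; exact ENNReal.ofReal_le_ofReal hp.le
  have hexp : 0 ≤ 1 / (1 : ℝ≥0∞).toReal - 1 / (ENNReal.ofReal p).toReal := by
    rw [ENNReal.toReal_ofReal (by linarith), ENNReal.toReal_one, sub_nonneg, div_one,
      div_le_one (by linarith)]
    exact hp.le
  refine ⟨eLpNormLESNormFDerivOfLeConst ℝ (volume : Measure (EuclideanSpace ℝ (Fin n))) Ω 1 1 *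
    volume Ω ^ (1 / (1 : ℝ≥0∞).toReal - 1 / (ENNReal.ofReal p).toReal),
    ENNReal.mul_ne_top ENNReal.coe_ne_top (ENNReal.rpow_ne_top_of_nonneg hexp hfin),
    fun φ hφ hc hs => ?_⟩
  -- The exponent `1` must be smaller than the dimension, which is where `2 ≤ n` enters.
  have h1 := eLpNorm_le_eLpNorm_fderiv_of_le (volume : Measure (EuclideanSpace ℝ (Fin n)))
    (u := φ) (s := Ω) (p := 1) (q := 1) (hφ.of_le (by simp)) ((subset_tsupport φ).trans hs) le_rfl
    (by simp; omega) (by simp) hbdd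
  have h2 : eLpNorm (fderiv ℝ φ) 1 volume = eLpNorm (gradient φ) 1 (volume.restrict Ω) := by
    rw [eLpNorm_restrict_eq_of_support_subset ((support_gradient_subset φ).trans hs)]
    exact eLpNorm_congr_norm_ae (Eventually.of_forall fun x => (norm_gradient_eq φ x).symm)
  have h3 := eLpNorm_le_eLpNorm_mul_rpow_measure_univ (μ := volume.restrict Ω) hp1
    (continuous_gradient hφ).aestronglyMeasurable
  rw [Measure.restrict_apply_univ] at h3
  calc eLpNorm φ 1 (volume.restrict Ω) ≤ eLpNorm φ 1 volume :=
        eLpNorm_mono_measure _ Measure.restrict_le_self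
    _ ≤ eLpNormLESNormFDerivOfLeConst ℝ (volume : Measure (EuclideanSpace ℝ (Fin n))) Ω 1 1 *
        eLpNorm (fderiv ℝ φ) 1 volume := by simpa using h1
    _ ≤ _ := by
        rw [h2, mul_assoc]
        gcongr
        rwa [mul_comm]

/-- Poincaré's inequality in `W₀^{1,p}`, with `L¹` norm on the left. -/
lemma exists_eLpNorm_one_le (hn : 2 ≤ n) (hp : 1 < p) (hbdd : Bornology.IsBounded Ω) :
    ∃ C : ℝ≥0∞, C ≠ ⊤ ∧ ∀ ψ g, MemSobolevZero p Ω ψ g →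
      eLpNorm ψ 1 (volume.restrict Ω) ≤
        C * eLpNorm g (ENNReal.ofReal p) (volume.restrict Ω) := by
  obtain ⟨C, hC, h⟩ := exists_eLpNorm_one_le_smooth hn hp hbdd
  have hfin : volume Ω ≠ ⊤ := hbdd.measure_lt_top.ne
  have hp1 : (1 : ℝ≥0∞) ≤ ENNReal.ofReal p := by
    rw [← ENNReal.ofReal_one]; exact ENNReal.ofReal_le_ofReal hp.le
  refine ⟨C, hC, ?_⟩
  rintro ψ g ⟨hψ, hg, φ, hφ, h1, h2⟩
  set μ := volume.restrict Ω
  set K : ℝ≥0∞ := volume Ω ^ (1 / (1 : ℝ≥0∞).toReal - 1 / (ENNReal.ofReal p).toReal)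
  have hK : K ≠ ⊤ := by
    refine ENNReal.rpow_ne_top_of_nonneg ?_ hfin
    rw [ENNReal.toReal_ofReal (by linarith), ENNReal.toReal_one, sub_nonneg, div_one,
      div_le_one (by linarith)]
    exact hp.le
  have hle : ∀ k, eLpNorm ψ 1 μ ≤ eLpNorm (fun x => φ k x - ψ x) (ENNReal.ofReal p) μ * K +
      C * (eLpNorm (fun x => gradient (φ k) x - g x) (ENNReal.ofReal p) μ +
        eLpNorm g (ENNReal.ofReal p) μ) := by
    intro k
    obtain ⟨hk1, hk2, hk3⟩ := hφ k
    have hm : AEStronglyMeasurable (fun x => φ k x - ψ x) μ :=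
      hk1.continuous.aestronglyMeasurable.sub hψ.1
    have hm' : AEStronglyMeasurable (fun x => gradient (φ k) x - g x) μ :=
      (continuous_gradient hk1).aestronglyMeasurable.sub hg.1
    have e1 : eLpNorm ψ 1 μ ≤ eLpNorm (fun x => φ k x - ψ x) 1 μ + eLpNorm (φ k) 1 μ := by
      have : ψ = φ k - fun x => φ k x - ψ x := by ext x; simp
      conv_lhs => rw [this]
      rw [add_comm]
      exact eLpNorm_sub_le hk1.continuous.aestronglyMeasurable hm le_rfl
    have e2 := eLpNorm_le_eLpNorm_mul_rpow_measure_univ (μ := μ) hp1 hm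
    rw [Measure.restrict_apply_univ] at e2
    have e3 : eLpNorm (gradient (φ k)) (ENNReal.ofReal p) μ ≤
        eLpNorm (fun x => gradient (φ k) x - g x) (ENNReal.ofReal p) μ +
          eLpNorm g (ENNReal.ofReal p) μ := by
      have : gradient (φ k) = (fun x => gradient (φ k) x - g x) + g := by ext x; simp
      conv_lhs => rw [this]
      exact eLpNorm_add_le hm' hg.1 hp1
    exact e1.trans (add_le_add e2 ((h _ hk1 hk2 hk3).trans (by gcongr)))
  have hlim := (ENNReal.Tendsto.mul_const h1 (Or.inr hK)).add
    (ENNReal.Tendsto.const_mul (h2.add_const (eLpNorm g (ENNReal.ofReal p) μ)) (Or.inr hC))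
  simp only [zero_mul, zero_add] at hlim
  exact ge_of_tendsto' hlim hle

lemma exists_integral_rpow_le (hn : 2 ≤ n) (hp : 1 < p) (hH : IsAnisotropicNorm H)
    (hbdd : Bornology.IsBounded Ω) :
    ∃ C : ℝ, 0 ≤ C ∧ ∀ ψ g, MemSobolevZero p Ω ψ g →
      |∫ x in Ω, ψ x| ^ p ≤ C * ∫ x in Ω, H (g x) ^ p := by
  obtain ⟨C, hC, h⟩ := exists_eLpNorm_one_le (Ω := Ω) hn hp hbdd
  obtain ⟨α, β, hα, -, hα'⟩ := hH.bounds
  have hp0 : 0 < p := by linarith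
  refine ⟨(C.toReal * α⁻¹) ^ p, by positivity, fun ψ g hψ => ?_⟩
  have h1 := h ψ g hψ
  have hg := hψ.2.1
  have h2 : |∫ x in Ω, ψ x| ≤ (eLpNorm ψ 1 (volume.restrict Ω)).toReal := by
    rw [eLpNorm_one_eq_lintegral_enorm, ← Real.norm_eq_abs]
    simp only [← ofReal_norm]
    exact norm_integral_le_lintegral_norm _
  have h3 : (eLpNorm g (ENNReal.ofReal p) (volume.restrict Ω)).toReal =
      (∫ x in Ω, ‖g x‖ ^ p) ^ p⁻¹ := by
    rw [hg.eLpNorm_eq_integral_rpow_norm (by simpa using hp0) (by simp),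
      ENNReal.toReal_ofReal hp0.le, ENNReal.toReal_ofReal]
    positivity
  have h4 : |∫ x in Ω, ψ x| ≤ C.toReal * (∫ x in Ω, ‖g x‖ ^ p) ^ p⁻¹ := by
    rw [← h3, ← ENNReal.toReal_mul]
    exact h2.trans (ENNReal.toReal_mono (ENNReal.mul_ne_top hC hg.eLpNorm_ne_top) h1)
  have h5 : ∫ x in Ω, ‖g x‖ ^ p ≤ (α⁻¹) ^ p * ∫ x in Ω, H (g x) ^ p := by
    rw [← integral_const_mul]
    refine integral_mono_of_nonneg (Eventually.of_forall fun x => by positivity)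
      ((hH.integrable_rpow hp hg).const_mul _) (Eventually.of_forall fun x => ?_)
    simp only
    rw [← Real.mul_rpow (by positivity) (hH.nonneg _)]
    gcongr
    rw [inv_mul_eq_div, le_div_iff₀ hα, mul_comm]
    exact (hα' _).1
  calc |∫ x in Ω, ψ x| ^ p ≤ (C.toReal * (∫ x in Ω, ‖g x‖ ^ p) ^ p⁻¹) ^ p := by gcongr
    _ = C.toReal ^ p * ∫ x in Ω, ‖g x‖ ^ p := by
        rw [Real.mul_rpow (by positivity) (by positivity),
          Real.rpow_inv_rpow (by positivity) hp0.ne']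
    _ ≤ C.toReal ^ p * ((α⁻¹) ^ p * ∫ x in Ω, H (g x) ^ p) := by gcongr
    _ = _ := by rw [Real.mul_rpow (by positivity) (by positivity)]; ring

/-- Needed because the real `sSup` of an unbounded set is `0`. -/
lemma bddAbove_torsionQuotients (hn : 2 ≤ n) (hp : 1 < p) (hH : IsAnisotropicNorm H)
    (hbdd : Bornology.IsBounded Ω) : BddAbove (torsionQuotients H p Ω) := by
  obtain ⟨C, hC, h⟩ := exists_integral_rpow_le (Ω := Ω) hn hp hH hbdd
  refine ⟨C, ?_⟩
  rintro _ ⟨ψ, g, hψ, -, hψ0, rfl⟩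
  have h1 := h ψ g hψ
  rw [abs_of_nonneg (integral_nonneg_of_ae hψ0)] at h1
  exact div_le_of_le_mul₀ (integral_nonneg fun x => Real.rpow_nonneg (hH.nonneg _) _) hC h1

lemma torsionQuotients_nonneg (hH : IsAnisotropicNorm H) {r : ℝ}
    (hr : r ∈ torsionQuotients H p Ω) : 0 ≤ r := by
  obtain ⟨ψ, g, -, -, hψ0, rfl⟩ := hr
  exact div_nonneg (Real.rpow_nonneg (integral_nonneg_of_ae hψ0) _)
    (integral_nonneg fun x => Real.rpow_nonneg (hH.nonneg _) _)

/-- The equation is tested with `u` itself, and Euler's identity evaluates the pairing. -/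
lemma IsTorsionFunction.integral_eq (hp : 1 < p) (hH : IsAnisotropicNorm H)
    {u : EuclideanSpace ℝ (Fin n) → ℝ}
    {g : EuclideanSpace ℝ (Fin n) → EuclideanSpace ℝ (Fin n)} (hu : IsTorsionFunction H p Ω u g) :
    ∫ x in Ω, u x = ∫ x in Ω, H (g x) ^ p := by
  rw [← hu.2 u g hu.1]
  refine integral_congr_ae (Eventually.of_forall fun x => ?_)
  simp only
  rcases eq_or_ne (g x) 0 with h | h
  · rw [h, inner_zero_right, mul_zero, hH.map_zero, Real.zero_rpow (by linarith)]
  · rw [hH.inner_gradient_self h, ← Real.rpow_add_one (hH.pos h).ne', sub_add_cancel]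

/-- The torsion function maximizes the quotients that define the torsional rigidity. -/
lemma IsTorsionFunction.mem_upperBounds (hp : 1 < p) (hH : IsAnisotropicNorm H)
    {u : EuclideanSpace ℝ (Fin n) → ℝ}
    {g : EuclideanSpace ℝ (Fin n) → EuclideanSpace ℝ (Fin n)} (hu : IsTorsionFunction H p Ω u g) :
    (∫ x in Ω, u x) ^ (p - 1) ∈ upperBounds (torsionQuotients H p Ω) := by
  rintro _ ⟨ψ, Dψ, hψ, -, hψ0, rfl⟩
  have hp0 : 0 < p := by linarith
  have hp1 : 0 < p - 1 := by linarith
  have hpq : p.HolderConjugate (p / (p - 1)) := Real.HolderConjugate.conjExponent hp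
  have hT : 0 ≤ ∫ x in Ω, H (g x) ^ p :=
    integral_nonneg fun x => Real.rpow_nonneg (hH.nonneg _) _
  have hD : 0 ≤ ∫ x in Ω, H (Dψ x) ^ p :=
    integral_nonneg fun x => Real.rpow_nonneg (hH.nonneg _) _
  rw [hu.integral_eq hp hH]
  have hm1 : MemLp (fun x => H (Dψ x)) (ENNReal.ofReal p) (volume.restrict Ω) :=
    hH.memLp_comp hψ.2.1
  have hm2 : MemLp (fun x => H (g x) ^ (p - 1)) (ENNReal.ofReal (p / (p - 1)))
      (volume.restrict Ω) := by
    have h := (hH.memLp_comp hu.1.2.1).norm_rpow_div (ENNReal.ofReal (p - 1))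
    rw [ENNReal.toReal_ofReal hp1.le, ← ENNReal.ofReal_div_of_pos hp1] at h
    simpa only [Real.norm_of_nonneg (hH.nonneg _)] using h
  have : (ENNReal.ofReal p).HolderTriple (ENNReal.ofReal (p / (p - 1))) 1 := hpq.ennrealOfReal
  have hint : Integrable (fun x => H (Dψ x) * H (g x) ^ (p - 1)) (volume.restrict Ω) :=
    hm1.integrable_mul hm2
  -- The equation tested with `ψ`, where `gradient H (g x)` has dual norm at most `1`; Hölder's
  -- inequality then separates the two gradients.
  have h1 : ∫ x in Ω, ψ x ≤ ∫ x in Ω, H (Dψ x) * H (g x) ^ (p - 1) := by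
    rw [← hu.2 ψ Dψ hψ]
    refine (Real.le_norm_self _).trans
      (norm_integral_le_of_norm_le hint (Eventually.of_forall fun x => ?_))
    rw [norm_mul, Real.norm_of_nonneg (Real.rpow_nonneg (hH.nonneg _) _), mul_comm]
    rcases eq_or_ne (g x) 0 with h | h
    · rw [h, hH.map_zero, Real.zero_rpow hp1.ne', mul_zero, mul_zero]
    · gcongr
      · exact Real.rpow_nonneg (hH.nonneg _) _
      · exact hH.abs_inner_le (hH.inner_gradient_le h) _
  have h2 := integral_mul_le_Lp_mul_Lq_of_nonneg hpq
    (Eventually.of_forall fun x => hH.nonneg (Dψ x))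
    (Eventually.of_forall fun x => Real.rpow_nonneg (hH.nonneg (g x)) (p - 1)) hm1 hm2
  have h3 : ∀ x, (H (g x) ^ (p - 1)) ^ (p / (p - 1)) = H (g x) ^ p := fun x => by
    rw [← Real.rpow_mul (hH.nonneg _)]
    congr 1
    field_simp
  simp only [h3] at h2
  refine div_le_of_le_mul₀ hD (Real.rpow_nonneg hT _) ?_
  calc (∫ x in Ω, ψ x) ^ p
      ≤ ((∫ x in Ω, H (Dψ x) ^ p) ^ (1 / p) * (∫ x in Ω, H (g x) ^ p) ^ (1 / (p / (p - 1)))) ^ p :=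
        Real.rpow_le_rpow (integral_nonneg_of_ae hψ0) (h1.trans h2) hp0.le
    _ = (∫ x in Ω, H (g x) ^ p) ^ (p - 1) * ∫ x in Ω, H (Dψ x) ^ p := by
        rw [Real.mul_rpow (by positivity) (by positivity), ← Real.rpow_mul hD, ← Real.rpow_mul hT,
          one_div_mul_cancel hp0.ne', Real.rpow_one, mul_comm]
        congr 2
        field_simp

end Sobolev

/-! ### The lower bound for every upper bound of the quotients. -/

section LowerBound

variable {n : ℕ} {H : EuclideanSpace ℝ (Fin n) → ℝ} {Ω : Set (EuclideanSpace ℝ (Fin n))} {p : ℝ}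

/-- A test function in the definition of the torsional rigidity, with the bounds it provides. -/
lemma integral_rpow_le_mul_of_mem_upperBounds (hn : 2 ≤ n) (hp : 1 < p)
    (hH : IsAnisotropicNorm H) (hbdd : Bornology.IsBounded Ω) {M : ℝ}
    (hM : M ∈ upperBounds (torsionQuotients H p Ω)) {φ : EuclideanSpace ℝ (Fin n) → ℝ}
    (hφ : ContDiff ℝ ∞ φ) (hc : HasCompactSupport φ) (hs : tsupport φ ⊆ Ω) (h0 : ∀ x, 0 ≤ φ x)
    (hpos : 0 < ∫ x in Ω, φ x) :
    0 ≤ M ∧ (∫ x in Ω, φ x) ^ p ≤ M * ∫ x in Ω, H (gradient φ x) ^ p := by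
  have hmem := memSobolevZero_of_smooth (p := p) hφ hc hs
  obtain ⟨C, -, hC⟩ := exists_integral_rpow_le (Ω := Ω) hn hp hH hbdd
  have h1 := hC _ _ hmem
  rw [abs_of_pos hpos] at h1
  have hD : 0 ≤ ∫ x in Ω, H (gradient φ x) ^ p :=
    integral_nonneg fun x => Real.rpow_nonneg (hH.nonneg _) _
  -- By Poincaré a vanishing denominator would force a vanishing numerator.
  have hD0 : 0 < ∫ x in Ω, H (gradient φ x) ^ p := by
    refine lt_of_le_of_ne hD fun h => ?_
    rw [← h, mul_zero] at h1
    exact not_lt.2 h1 (Real.rpow_pos_of_pos hpos p)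
  have hq : (∫ x in Ω, φ x) ^ p / ∫ x in Ω, H (gradient φ x) ^ p ∈ torsionQuotients H p Ω := by
    refine ⟨φ, gradient φ, hmem, fun h => ?_, Eventually.of_forall h0, rfl⟩
    rw [integral_congr_ae h] at hpos
    simp at hpos
  exact ⟨(torsionQuotients_nonneg hH hq).trans (hM hq), (div_le_iff₀ hD0).1 (hM hq)⟩

/-- The main estimate: every upper bound of the quotients is at least the volume-perimeter
quotient. -/
lemma le_of_mem_upperBounds (hn : 2 ≤ n) (hp : 1 < p)
    (hH : IsAnisotropicNorm H) (hne : Ω.Nonempty) (hopen : IsOpen Ω) (hconv : Convex ℝ Ω)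
    (hbdd : Bornology.IsBounded Ω) (hP : anisotropicPerimeter H Ω ≠ ⊤) {M : ℝ}
    (hM : M ∈ upperBounds (torsionQuotients H p Ω)) :
    0 < (anisotropicPerimeter H Ω).toReal ∧
    (((p - 1) / (2 * p - 1) * volume.real Ω ^ ((2 * p - 1) / (p - 1))) /
      (anisotropicPerimeter H Ω).toReal ^ (p / (p - 1))) ^ (p - 1) ≤ M := by
  obtain ⟨δ, hδpos, hδW, hδlayer⟩ := exists_boundaryDist hn hH hne hopen hconv hbdd hP
  have hδc : Continuous δ := hH.continuous_of_abs_sub_le hδW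
  set P := (anisotropicPerimeter H Ω).toReal with hPdef
  set μ := volume.restrict Ω with hμ
  have hfinΩ : volume Ω < ⊤ := hbdd.measure_lt_top
  have : IsFiniteMeasure μ := ⟨by rwa [hμ, Measure.restrict_apply_univ]⟩
  have hPnn : 0 ≤ P := ENNReal.toReal_nonneg
  have hlayer : ∀ s t, s ≤ t → μ.real {x | δ x ∈ Set.Ioo s t} ≤ P * (t - s) := by
    intro s t hst
    have h := hδlayer s t
    rw [measureReal_def, hμ, Measure.restrict_apply' hopen.measurableSet,
      ← ENNReal.toReal_ofReal (sub_nonneg.2 hst), hPdef, mul_comm, ← ENNReal.toReal_mul]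
    refine ENNReal.toReal_mono (ENNReal.mul_ne_top ENNReal.ofReal_ne_top hP) (le_trans ?_ h)
    exact measure_mono fun x hx => ⟨hx.2, hx.1⟩
  have hpos : ∀ᵐ x ∂μ, 0 < δ x :=
    (ae_restrict_mem hopen.measurableSet).mono fun x hx => (hδpos x).2 hx
  obtain ⟨R, hR0, hR⟩ : ∃ R, 0 ≤ R ∧ ∀ᵐ x ∂μ, δ x ≤ R := by
    obtain ⟨R, hR⟩ := (hbdd.isCompact_closure.image hδc).bddAbove
    obtain ⟨y, hy⟩ := hne
    have hle : ∀ x ∈ Ω, δ x ≤ R := fun x hx => hR ⟨x, subset_closure hx, rfl⟩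
    exact ⟨R, ((hδpos y).2 hy).le.trans (hle y hy),
      (ae_restrict_mem hopen.measurableSet).mono hle⟩
  have hv : μ.real Set.univ = volume.real Ω := by simp [hμ, measureReal_def]
  have hv0 : 0 < volume.real Ω :=
    ENNReal.toReal_pos (hopen.measure_pos volume hne).ne' hfinΩ.ne
  -- If `P = 0`, the tail could not fall from `|Ω|` at `0` to `0` at `R`.
  have hP0 : 0 < P := by
    have h := tailMeasure_sub_le hlayer hR0
    rw [tailMeasure_of_ge hR, tailMeasure_of_nonpos hpos le_rfl, hv] at h
    by_contra hcon
    have : P = 0 := le_antisymm (not_lt.1 hcon) hPnn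
    rw [this] at h
    linarith
  refine ⟨hP0, ?_⟩
  have hp1 : 0 < p - 1 := by linarith
  -- With this exponent `θ p = 1 + θ`, so numerator and denominator involve the same power `V ^ q`.
  set θ : ℝ := 1 / (p - 1) with hθ
  have hθ0 : 0 < θ := by positivity
  set q : ℝ := 1 + θ with hq
  have hq0 : 0 < q := by positivity
  have hθp : θ * p = q := by rw [hq, hθ]; field_simp; ring
  set A : ℝ := volume.real Ω ^ (q + 1) / (q + 1) with hA
  have hA0 : 0 < A := by positivity
  set V := tailMeasure μ δ with hV
  set f := tailPrimitive μ δ θ with hf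
  have hVc : Continuous V := continuous_tailMeasure hPnn hlayer
  have hfc : Continuous f := continuous_iff_continuousAt.2 fun t =>
    (hasDerivAt_tailPrimitive hPnn hlayer hθ0 t).continuousAt
  have hfm : Monotone f := tailPrimitive_monotone hPnn hlayer hθ0
  have hf0 : f 0 = 0 := tailPrimitive_zero θ
  have hfpos : ∀ t, 0 ≤ t → 0 ≤ f t := fun t ht => hf0.ge.trans (hfm ht)
  have hfnn : ∀ t, 0 ≤ f (max t 0) := fun t => hfpos _ (le_max_right t 0)
  have hVnn : ∀ t, 0 ≤ V t := tailMeasure_nonneg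
  have hVle : ∀ t, V t ≤ volume.real Ω := fun t => hv ▸ tailMeasure_le t
  set I : ℝ := ∫ x, f (δ x) ∂μ with hI
  set J : ℝ := ∫ x, V (δ x) ^ q ∂μ with hJ
  have hVq : Continuous fun t => V t ^ q := hVc.rpow_const fun _ => Or.inr hq0.le
  have hVqle : ∀ t, ‖V t ^ q‖ ≤ volume.real Ω ^ q := fun t => by
    rw [Real.norm_of_nonneg (Real.rpow_nonneg (hVnn t) q)]
    exact Real.rpow_le_rpow (hVnn t) (hVle t) hq0.le
  have hJle : J ≤ A := by
    have h := lintegral_tailMeasure_comp_le hδc.measurable hPnn hlayer hpos hR hR0 hq0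
    rw [hv, ← ofReal_integral_eq_lintegral_ofReal] at h
    · exact (ENNReal.ofReal_le_ofReal_iff hA0.le).1 h
    · exact Integrable.of_bound (hVq.comp hδc).aestronglyMeasurable _
        (Eventually.of_forall fun x => hVqle (δ x))
    · exact Eventually.of_forall fun x => Real.rpow_nonneg (hVnn _) q
  have hIint : Integrable (fun x => f (δ x)) μ := by
    refine Integrable.of_bound (hfc.comp hδc).aestronglyMeasurable (f R) ?_
    filter_upwards [hpos, hR] with x hx hx'
    rw [Real.norm_of_nonneg (hfpos _ hx.le)]
    exact hfm hx'
  have hIge : A ≤ P * I := by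
    have h := le_lintegral_tailMeasure hP0 hlayer hpos hq0
    rw [hv, hq, ← lintegral_tailPrimitive hδc.measurable hPnn hlayer hpos hθ0,
      ← ofReal_integral_eq_lintegral_ofReal hIint (hpos.mono fun x hx => hfpos _ hx.le),
      ← ENNReal.ofReal_mul hPnn] at h
    refine (ENNReal.ofReal_le_ofReal_iff (mul_nonneg hPnn ?_)).1 h
    exact integral_nonneg_of_ae (hpos.mono fun x hx => hfpos _ hx.le)
  have hI0 : 0 < I := by
    by_contra hcon
    nlinarith [not_lt.1 hcon]
  have hIlim : Tendsto (fun ε : ℝ => ∫ x, f (max (δ x - ε) 0) ∂μ) (𝓝[>] 0) (𝓝 I) := by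
    refine tendsto_integral_filter_of_dominated_convergence (fun _ => f R)
      (Eventually.of_forall fun ε => Continuous.aestronglyMeasurable (by fun_prop)) ?_
      (integrable_const _) ?_
    · filter_upwards [self_mem_nhdsWithin] with ε (hε : 0 < ε)
      filter_upwards [hR] with x hx
      rw [Real.norm_of_nonneg (hfnn _)]
      exact hfm (max_le (by linarith) hR0)
    · filter_upwards [hpos] with x hx
      have h : Tendsto (fun ε : ℝ => f (max (δ x - ε) 0)) (𝓝[>] 0) (𝓝 (f (max (δ x - 0) 0))) :=
        (Continuous.tendsto (by fun_prop) 0).mono_left nhdsWithin_le_nhds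
      rwa [sub_zero, max_eq_left hx.le] at h
  have hJlim : Tendsto (fun ε : ℝ => ∫ x, V (δ x - ε) ^ q ∂μ) (𝓝[>] 0) (𝓝 J) := by
    refine tendsto_integral_filter_of_dominated_convergence (fun _ => volume.real Ω ^ q)
      (Eventually.of_forall fun ε => (hVq.comp (hδc.sub continuous_const)).aestronglyMeasurable)
      (Eventually.of_forall fun ε => Eventually.of_forall fun x => hVqle _)
      (integrable_const _) (Eventually.of_forall fun x => ?_)
    have h : Tendsto (fun ε : ℝ => V (δ x - ε) ^ q) (𝓝[>] 0) (𝓝 (V (δ x - 0) ^ q)) :=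
      ((hVq.comp (continuous_const.sub continuous_id)).tendsto 0).mono_left nhdsWithin_le_nhds
    rwa [sub_zero] at h
  have hmain : ∀ᶠ ε : ℝ in 𝓝[>] 0, 0 ≤ M ∧
      (∫ x, f (max (δ x - ε) 0) ∂μ) ^ p ≤ M * ∫ x, V (δ x - ε) ^ q ∂μ := by
    filter_upwards [self_mem_nhdsWithin, hIlim.eventually (lt_mem_nhds hI0)] with ε (hε : 0 < ε) hIε
    obtain ⟨φ, hφ, hc, hs, hφge, hgrad⟩ := exists_smooth_comp_boundaryDist hH hbdd hδpos hδW hfc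
      hfm hf0 (fun a => Real.rpow_nonneg (hVnn a) θ)
      (fun a s t hs ht => tailPrimitive_sub_le hPnn hlayer hθ0 hs ht) hε
    have h1 : ∫ x, f (max (δ x - ε) 0) ∂μ ≤ ∫ x in Ω, φ x :=
      integral_mono_of_nonneg (Eventually.of_forall fun x => hfnn _)
        (hφ.continuous.integrable_of_hasCompactSupport hc).restrict (Eventually.of_forall hφge)
    obtain ⟨hM0, h2⟩ := integral_rpow_le_mul_of_mem_upperBounds hn hp hH hbdd hM hφ hc hs
      (fun x => (hfnn _).trans (hφge x)) (hIε.trans_le h1)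
    refine ⟨hM0, (Real.rpow_le_rpow hIε.le h1 (by linarith)).trans (h2.trans ?_)⟩
    have hint : Integrable (fun x => V (δ x - ε) ^ q) μ :=
      Integrable.of_bound (hVq.comp (hδc.sub continuous_const)).aestronglyMeasurable _
        (Eventually.of_forall fun x => hVqle (δ x - ε))
    refine mul_le_mul_of_nonneg_left (integral_mono_of_nonneg
      (Eventually.of_forall fun x => Real.rpow_nonneg (hH.nonneg _) _) hint
      (Eventually.of_forall fun x => ?_)) hM0
    simp only
    rw [← hθp, Real.rpow_mul (hVnn _)]
    exact Real.rpow_le_rpow (hH.nonneg _) (hgrad x) (by linarith)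
  obtain ⟨-, hM0, -⟩ := hmain.exists
  have hlim : I ^ p ≤ M * J :=
    le_of_tendsto_of_tendsto (hIlim.rpow_const (Or.inr (by linarith))) (hJlim.const_mul M)
      (hmain.mono fun _ h => h.2)
  have hAP : A / P ≤ I := by rw [div_le_iff₀ hP0, mul_comm]; exact hIge
  -- This is `(A/P)^p ≤ I^p ≤ M J ≤ M A`; dividing by `A` gives the claim.
  have h1 : (A / P) ^ p ≤ M * A :=
    (Real.rpow_le_rpow (by positivity) hAP (by linarith)).trans
      (hlim.trans (mul_le_mul_of_nonneg_left hJle hM0))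
  have hAeq : (p - 1) / (2 * p - 1) * volume.real Ω ^ ((2 * p - 1) / (p - 1)) = A := by
    have e : (2 * p - 1) / (p - 1) = q + 1 := by rw [hq, hθ]; field_simp; ring
    have e' : (p - 1) / (2 * p - 1) = (q + 1)⁻¹ := by rw [← e, inv_div]
    rw [e, e', hA]; ring
  rw [hAeq, Real.div_rpow hA0.le (by positivity), ← Real.rpow_mul hPnn,
    div_mul_cancel₀ _ hp1.ne', div_le_iff₀ (by positivity)]
  rw [Real.div_rpow hA0.le hPnn, div_le_iff₀ (by positivity)] at h1
  have h2 : A ^ p = A ^ (p - 1) * A := by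
    rw [← Real.rpow_add_one hA0.ne', sub_add_cancel]
  rw [h2] at h1
  nlinarith

/-- The lower bound in `ℝ≥0∞`, for a number whose power bounds the quotients. -/
lemma ofReal_le_of_mem_upperBounds (hn : 2 ≤ n) (hp : 1 < p)
    (hH : IsAnisotropicNorm H) (hne : Ω.Nonempty) (hopen : IsOpen Ω) (hconv : Convex ℝ Ω)
    (hbdd : Bornology.IsBounded Ω) {T : ℝ} (hT0 : 0 ≤ T)
    (hT : T ^ (p - 1) ∈ upperBounds (torsionQuotients H p Ω)) :
    ENNReal.ofReal ((p - 1) / (2 * p - 1)) * volume Ω ^ ((2 * p - 1) / (p - 1)) /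
        anisotropicPerimeter H Ω ^ (p / (p - 1)) ≤ ENNReal.ofReal T := by
  have hp1 : 0 < p - 1 := by linarith
  have hp2 : 0 < 2 * p - 1 := by linarith
  have he : 0 < (2 * p - 1) / (p - 1) := by positivity
  have he' : 0 < p / (p - 1) := by positivity
  -- For an infinite perimeter the left side is a quotient by `⊤`, that is `0`.
  by_cases hP : anisotropicPerimeter H Ω = ⊤
  · rw [hP, ENNReal.top_rpow_of_pos he', ENNReal.div_top]
    exact bot_le
  obtain ⟨hP0, h⟩ := le_of_mem_upperBounds hn hp hH hne hopen hconv hbdd hP hT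
  rw [Real.rpow_le_rpow_iff (by positivity) hT0 hp1] at h
  have hfin : volume Ω ≠ ⊤ := hbdd.measure_lt_top.ne
  rw [← ENNReal.ofReal_toReal hP, ← ENNReal.ofReal_toReal hfin,
    ENNReal.ofReal_rpow_of_nonneg ENNReal.toReal_nonneg he.le,
    ENNReal.ofReal_rpow_of_pos hP0, ← ENNReal.ofReal_mul (by positivity),
    ← ENNReal.ofReal_div_of_pos (by positivity)]
  exact ENNReal.ofReal_le_ofReal h

end LowerBound

/-- Both bounds are one statement, applied to two nonnegative numbers whose `(p-1)`-th powers bound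
the quotients: the rigidity by definition of the supremum, `∫ u` by Hölder's inequality. -/
theorem theorem5p1 {n : ℕ} (hn : 2 ≤ n) (p : ℝ) (hp : 1 < p)
    (H : EuclideanSpace ℝ (Fin n) → ℝ) (hH : IsAnisotropicNorm H)
    (Ω : Set (EuclideanSpace ℝ (Fin n))) (hne : Ω.Nonempty) (hopen : IsOpen Ω)
    (hconv : Convex ℝ Ω) (hbdd : Bornology.IsBounded Ω) :
    ENNReal.ofReal ((p - 1) / (2 * p - 1)) * volume Ω ^ ((2 * p - 1) / (p - 1)) /
        anisotropicPerimeter H Ω ^ (p / (p - 1)) ≤ ENNReal.ofReal (torsionalRigidity H p Ω) ∧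
    ∀ u g, IsTorsionFunction H p Ω u g →
      ENNReal.ofReal ((p - 1) / (2 * p - 1)) * volume Ω ^ ((2 * p - 1) / (p - 1)) /
        anisotropicPerimeter H Ω ^ (p / (p - 1)) ≤ ENNReal.ofReal (∫ x in Ω, u x) := by
  have hp1 : p - 1 ≠ 0 := by linarith
  have hS : 0 ≤ sSup (torsionQuotients H p Ω) :=
    Real.sSup_nonneg fun r hr => torsionQuotients_nonneg hH hr
  refine ⟨ofReal_le_of_mem_upperBounds hn hp hH hne hopen hconv hbdd (Real.rpow_nonneg hS _) ?_,
    fun u g hu => ofReal_le_of_mem_upperBounds hn hp hH hne hopen hconv hbdd ?_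
      (hu.mem_upperBounds hp hH)⟩
  · rw [torsionalRigidity, one_div, Real.rpow_inv_rpow hS hp1]
    exact fun r hr => le_csSup (bddAbove_torsionQuotients hn hp hH hbdd) hr
  · rw [hu.integral_eq hp hH]
    exact integral_nonneg fun x => Real.rpow_nonneg (hH.nonneg _) _
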